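/- There is an absolute constant $N$ with the following property. Let $K$ be a field (of any characteristic) and let $L$ be a Lie algebra over $K$ of arbitrary, possibly infinite, dimension. Suppose that the group of $K$-linear Lie algebra automorphisms of $L$ contains a finite Frobenius group $FH$ with cyclic kernel $F$ and complement $H$ of order $2$; that is, $FH$ is a finite subgroup which is the semidirect product of a non-trivial normal cyclic subgroup $F$ and a subgroup $H$ of order $2$ such that $C_H(f)=1$ for every $1\neq f\in F$. For a group $G$ of automorphisms of $L$ write $C_L(G)=\{x\in L : x^{\varphi}=x \text{ for all } \varphi\in G\}$ for the fixed-point subalgebra. If $C_L(F)=0$ and $C_L(H)$ is metabelian, i.e. $[[C_L(H),C_L(H)],[C_L(H),C_L(H)]]=0$, then $L$ is solvable of derived length at most $N$, i.e. $L^{(N)}=0$, where $L^{(0)}=L$ and $L^{(i+1)}=[L^{(i)},L^{(i)}]$. In particular, $N$ depends neither on $|F|$, nor on $K$, nor on $L$. -/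

import Mathlib

/-- The automorphisms of a Lie algebra form a group under composition:
`(φ * ψ) x = φ (ψ x)`. -/
instance LieEquiv.instGroupAut {K L : Type*} [CommRing K] [LieRing L] [LieAlgebra K L] :
    Group (L ≃ₗ⁅K⁆ L) where
  mul φ ψ := ψ.trans φ
  one := 1
  inv φ := φ.symm
  mul_assoc _ _ _ := rfl
  one_mul _ := rfl
  mul_one _ := rfl
  inv_mul_cancel φ := by
    apply LieEquiv.coe_injective
    funext x
    exact φ.symm_apply_apply x

/-- The subgroup generated by `F` and `H` is a finite Frobenius group `FH` with kernel `F` and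
complement `H`: it is the semidirect product of a non-trivial normal subgroup `F` and a
non-trivial subgroup `H` such that `C_H(f) = 1` for every non-identity `f` in `F`. -/
structure IsFiniteFrobenius {A : Type*} [Group A] (F H : Subgroup A) : Prop where
  finite : Finite ↥(F ⊔ H)
  kernel_ne_bot : F ≠ ⊥
  complement_ne_bot : H ≠ ⊥
  conj_mem : ∀ h ∈ H, ∀ f ∈ F, h * f * h⁻¹ ∈ F
  disjoint : Disjoint F H
  fixedPointFree : ∀ f ∈ F, f ≠ 1 → ∀ h ∈ H, h * f = f * h → h = 1

/-- The fixed-point subalgebra `C_L(G)` of a group `G` of automorphisms of `L`. -/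
def fixedPointSubalgebra {K L : Type*} [CommRing K] [LieRing L] [LieAlgebra K L]
    (G : Subgroup (L ≃ₗ⁅K⁆ L)) : LieSubalgebra K L where
  carrier := {x | ∀ φ ∈ G, φ x = x}
  add_mem' := by
    intro x y hx hy φ hφ
    rw [map_add, hx φ hφ, hy φ hφ]
  zero_mem' := by
    intro φ _
    exact map_zero φ
  smul_mem' := by
    intro c x hx φ hφ
    rw [map_smul, hx φ hφ]
  lie_mem' := by
    intro x y hx hy φ hφ
    rw [LieEquiv.map_lie, hx φ hφ, hy φ hφ]

/-- `L` is solvable of derived length at most `n`: `L^(n) = 0`, where `L^(0) = L` and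
`L^(i+1) = [L^(i), L^(i)]`. -/
def DerivedLengthLE (K L : Type*) [CommRing K] [LieRing L] [LieAlgebra K L] (n : ℕ) : Prop :=
  LieAlgebra.derivedSeries K L n = ⊥

/-- `L` is metabelian: `[[L, L], [L, L]] = 0`. -/
def IsMetabelianLie (K L : Type*) [CommRing K] [LieRing L] [LieAlgebra K L] : Prop :=
  DerivedLengthLE K L 2

/-!
Over the algebraic closure, a power of a generator of `F`, of order `n` prime to the
characteristic, decomposes the algebra into eigenspaces `g i`, `i : ZMod n`, and `n` is odd. They
multiply like a grading, `g 0 = ⊥` since `F` has no fixed points (in characteristic `q` the maps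
`Φ ^ q ^ k - 1` and `Φ - 1` are injective together), and an element `η` of order `2` in `H`
inverts `F`, hence maps `g i` into `g (-i)`. Every `u + η u` lies in `C_L(H)`, so
`[[x + η x, y + η y], [z + η z, w + η w]] = 0`; for homogeneous elements of weights `a, b, c, d`
the term `[[x, y], [z, w]]` is the only one of its weight in the expansion unless some sum `v + u`
with `v ∈ {a, b, a + b}`, `u ∈ {c, d, c + d}` vanishes or the term is zero because one of
`a, b, a + b, c, d, c + d` is. This is the *selective metabelian condition*
(`IsSelectivelyMetabelian`), and the rest is a statement on families of submodules indexed by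
`ZMod n`: with the selective condition and `g 0 = ⊥` the derived length is bounded by an absolute
constant (`exists_forall_derivedIter_eq_bot`).

*Relative Shalev theorem* (`derivedIter_shalevBound_le`). If all but `r` components of `g` lie in
a family `z` absorbing brackets with `g`, and `g 0` does too, then so does a term of the derived
series of `g` whose number depends only on `r`. The weights are removed in the order
`1, 2, …, n - 1`.

*Elimination* (`EliminationOrder.derivedIter_le`). For suitable short lists `D` of weights, a
bounded term of the derived series lies in the subalgebra `B` generated by the components of
weight outside `D`. One weight is added at a time; the step needs that bracketing `g` boundedly
often with `B` leads into `B` (`lieChain_nilBound_le`). Indeed a bounded term of the derived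
series of `B` does so at once by the relative Shalev theorem, applied to the elements that
multiply `g` into `B`, and one climbs up the derived series of `B` by collecting equal weights:
progressions leave `D` after boundedly many steps.

*Killing brackets* (`IsSelectivelyMetabelian.lie_lie_eq_zero`). If `D` contains `-a`, `-b`,
`-(a + b)` and is invariant under `j ↦ t - j`, then a bounded derived component of weight `t` is
spanned by brackets of elements with weights outside `D`, so the selective condition makes
`[[g a, g b], -]` vanish on it. With the six-element lists
`t - {-a, -b, -(a + b)} ∪ {-a, -b, -(a + b)}` this applies to all but boundedly many `t` when `a`,
`b` are not in special position; and, with `b = t`, it yields an Engel condition for the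
components whose weight has large order. Special positions are avoided by eliminating first the
weights `-s` and `2 s`, where `s = a + b`.

*Conclusion* (`lie_derivedIter_eq_zero`). Let `x = [x₁, x₂]` be homogeneous, with weights not in
special position, and let `M` be a bounded term of the derived series. All but boundedly many
components of `M` annihilate `x`, and modulo shorter words the letters of `[x, m₁, …, m_k]`
commute, so that only boundedly many weights occur in the ideal generated by `x` under `M`. The
relative Shalev theorem, applied to the centralizer of this ideal, shows that `x` commutes with a
bounded term of the derived series of `M`.
-/

/-! ### Graded families, derived families and words -/

section Families

variable {K L A : Type*} [CommRing K] [LieRing L] [LieAlgebra K L] [AddCommGroup A]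

/-- A family of submodules indexed by an additive group is graded when brackets add weights. Neither
independence of the members nor that they span the algebra is part of the definition. -/
def IsGradedFamily (g : A → Submodule K L) : Prop :=
  ∀ ⦃a b i : A⦄ ⦃x y : L⦄, a + b = i → x ∈ g a → y ∈ g b → ⁅x, y⁆ ∈ g i

/-- The family `z` absorbs brackets with the members of `g`, and so behaves like an ideal graded
compatibly with `g`. -/
def AbsorbsFamily (z g : A → Submodule K L) : Prop :=
  ∀ ⦃a b i : A⦄ ⦃x y : L⦄, a + b = i → x ∈ z a → y ∈ g b → ⁅x, y⁆ ∈ z i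

/-- The derived family: its member of weight `i` is spanned by the brackets of members of `g` whose
weights add up to `i`. -/
def derivedFamily (g : A → Submodule K L) (i : A) : Submodule K L :=
  Submodule.span K {z | ∃ a b x y, a + b = i ∧ x ∈ g a ∧ y ∈ g b ∧ z = ⁅x, y⁆}

/-- The `k`-th derived family. -/
def derivedIter (g : A → Submodule K L) : ℕ → A → Submodule K L
  | 0 => g
  | k + 1 => derivedFamily (derivedIter g k)

/-- Left-normed words of weight `i` in letters taken from the members of `g` whose weight lies in
`S`. -/
inductive IsWord (g : A → Submodule K L) (S : Set A) : A → L → Prop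
  | letter {i : A} {x : L} : i ∈ S → x ∈ g i → IsWord g S i x
  | snoc {a b i : A} {x y : L} :
      IsWord g S a x → b ∈ S → y ∈ g b → a + b = i → IsWord g S i ⁅x, y⁆

/-- The member of weight `i` of the graded subalgebra generated by the members of `g` whose weight
lies in `S`, presented through left-normed words. -/
def genFamily (g : A → Submodule K L) (S : Set A) (i : A) : Submodule K L :=
  Submodule.span K {x | IsWord g S i x}

variable {g f h z : A → Submodule K L} {S : Set A}

theorem lie_mem_of_mem_span_right {Z : Submodule K L} {t : Set L} {x y : L}
    (h : ∀ y ∈ t, ⁅x, y⁆ ∈ Z) (hy : y ∈ Submodule.span K t) : ⁅x, y⁆ ∈ Z :=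
  (Submodule.span_le (p := Z.comap (LieAlgebra.ad K L x))).2 h hy

theorem lie_mem_of_mem_span_left {Z : Submodule K L} {s : Set L} {x y : L}
    (h : ∀ x ∈ s, ⁅x, y⁆ ∈ Z) (hx : x ∈ Submodule.span K s) : ⁅x, y⁆ ∈ Z := by
  rw [← lie_skew]
  refine Submodule.neg_mem _ (lie_mem_of_mem_span_right (fun x hx => ?_) hx)
  rw [← lie_skew]
  exact Submodule.neg_mem _ (h x hx)

theorem lie_mem_of_mem_span {Z : Submodule K L} {s t : Set L} {x y : L}
    (h : ∀ x ∈ s, ∀ y ∈ t, ⁅x, y⁆ ∈ Z) (hx : x ∈ Submodule.span K s)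
    (hy : y ∈ Submodule.span K t) : ⁅x, y⁆ ∈ Z :=
  lie_mem_of_mem_span_left (fun x hx => lie_mem_of_mem_span_right (h x hx) hy) hx

theorem derivedFamily_bracket_mem {a b i : A} {x y : L} (hi : a + b = i) (hx : x ∈ g a)
    (hy : y ∈ g b) : ⁅x, y⁆ ∈ derivedFamily g i :=
  Submodule.subset_span ⟨a, b, x, y, hi, hx, hy, rfl⟩

theorem derivedFamily_le {i : A} {Y : Submodule K L}
    (hY : ∀ a b x y, a + b = i → x ∈ g a → y ∈ g b → ⁅x, y⁆ ∈ Y) : derivedFamily g i ≤ Y := by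
  refine Submodule.span_le.2 ?_
  rintro _ ⟨a, b, x, y, hi, hx, hy, rfl⟩
  exact hY a b x y hi hx hy

theorem derivedIter_derivedIter (g : A → Submodule K L) (k m : ℕ) :
    derivedIter (derivedIter g k) m = derivedIter g (k + m) := by
  induction m with
  | zero => rfl
  | succ m ih => rw [derivedIter, ih]; rfl

theorem IsGradedFamily.derivedFamily_le_self (hg : IsGradedFamily g) : derivedFamily g ≤ g :=
  fun _ => derivedFamily_le fun _ _ _ _ hi hx hy => hg hi hx hy

theorem IsGradedFamily.derivedFamily (hg : IsGradedFamily g) :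
    IsGradedFamily (derivedFamily g) := fun _ _ _ _ _ hi hx hy =>
  derivedFamily_bracket_mem hi (hg.derivedFamily_le_self _ hx) (hg.derivedFamily_le_self _ hy)

theorem IsGradedFamily.derivedIter (hg : IsGradedFamily g) :
    ∀ k, IsGradedFamily (derivedIter g k)
  | 0 => hg
  | k + 1 => (hg.derivedIter k).derivedFamily

theorem IsGradedFamily.derivedIter_succ_le (hg : IsGradedFamily g) (k : ℕ) :
    _root_.derivedIter g (k + 1) ≤ _root_.derivedIter g k :=
  (hg.derivedIter k).derivedFamily_le_self

theorem IsGradedFamily.derivedIter_antitone (hg : IsGradedFamily g) :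
    Antitone (_root_.derivedIter g) :=
  antitone_nat_of_succ_le hg.derivedIter_succ_le

theorem IsGradedFamily.derivedIter_le (hg : IsGradedFamily g) (k : ℕ) :
    _root_.derivedIter g k ≤ g :=
  hg.derivedIter_antitone (Nat.zero_le k)

theorem derivedIter_apply_zero (hg : IsGradedFamily g) (h0 : g 0 = ⊥) (k : ℕ) :
    derivedIter g k 0 = ⊥ :=
  le_bot_iff.1 (h0 ▸ hg.derivedIter_le k 0)

theorem AbsorbsFamily.derivedFamily (hz : AbsorbsFamily z g) :
    AbsorbsFamily (derivedFamily z) g := by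
  intro a b i x y hi hx hy
  refine lie_mem_of_mem_span_left ?_ hx
  rintro _ ⟨a₁, a₂, x₁, x₂, ha, h₁, h₂, rfl⟩
  have e : ⁅⁅x₁, x₂⁆, y⁆ = ⁅x₁, ⁅x₂, y⁆⁆ + ⁅⁅x₁, y⁆, x₂⁆ := by
    rw [lie_lie x₁ x₂ y, ← lie_skew ⁅x₁, y⁆ x₂, sub_eq_add_neg]
  rw [e]
  refine Submodule.add_mem _ ?_ ?_
  · exact derivedFamily_bracket_mem (a := a₁) (b := a₂ + b) (by rw [← hi, ← ha]; abel)
      h₁ (hz rfl h₂ hy)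
  · exact derivedFamily_bracket_mem (a := a₁ + b) (b := a₂) (by rw [← hi, ← ha]; abel)
      (hz rfl h₁ hy) h₂

theorem IsGradedFamily.absorbsFamily_derivedIter (hg : IsGradedFamily g) :
    ∀ k, AbsorbsFamily (_root_.derivedIter g k) g
  | 0 => hg
  | k + 1 => (hg.absorbsFamily_derivedIter k).derivedFamily

theorem AbsorbsFamily.mono (hz : AbsorbsFamily z g) (hf : f ≤ g) : AbsorbsFamily z f :=
  fun _ b _ _ _ hi hx hy => hz hi hx (hf b hy)

theorem IsWord.mem (hg : IsGradedFamily g) (hfg : f ≤ g) {i : A} {x : L} (hx : IsWord f S i x) :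
    x ∈ g i := by
  induction hx with
  | letter _ hx => exact hfg _ hx
  | snoc _ _ hy hi ih => exact hg hi ih (hfg _ hy)

theorem IsGradedFamily.genFamily_le (hg : IsGradedFamily g) (S : Set A) : genFamily g S ≤ g :=
  fun _ => Submodule.span_le.2 fun _ hx => IsWord.mem hg le_rfl hx

theorem le_genFamily {i : A} (hi : i ∈ S) : g i ≤ genFamily g S i :=
  fun _ hx => Submodule.subset_span (.letter hi hx)

/-- A bracket of `x` with an element of a generated subalgebra is a combination of elements ending
with a single letter. This is the Jacobi identity in the form
`[x, [y, u]] = [[x, y], u] - [[x, u], y]`, by induction on the length of the word. -/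
theorem bracket_genFamily_mem
    (hh : ∀ ⦃a c i : A⦄ ⦃x u : L⦄, c ∈ S → a + c = i → x ∈ h a → u ∈ f c → ⁅x, u⁆ ∈ h i)
    {Y : Submodule K L} {i : A}
    (hY : ∀ ⦃a c : A⦄ ⦃x u : L⦄, c ∈ S → a + c = i → x ∈ h a → u ∈ f c → ⁅x, u⁆ ∈ Y)
    {a b : A} {x y : L} (hi : a + b = i) (hx : x ∈ h a) (hy : y ∈ genFamily f S b) :
    ⁅x, y⁆ ∈ Y := by
  refine lie_mem_of_mem_span_right (fun y' hy' => ?_) hy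
  clear hy y
  have hw : IsWord f S b y' := hy'
  clear hy'
  induction hw generalizing a x i Y with
  | letter hb hy => exact hY hb hi hx hy
  | @snoc b₁ b₂ b y u _ hb₂ hu hb ih =>
    have e : ⁅x, ⁅y, u⁆⁆ = ⁅⁅x, y⁆, u⁆ - ⁅⁅x, u⁆, y⁆ := by
      rw [leibniz_lie x y u, ← lie_skew y ⁅x, u⁆]; abel
    rw [e]
    refine Submodule.sub_mem _ ?_ ?_
    · exact hY hb₂ (a := a + b₁) (by rw [← hi, ← hb]; abel)
        (ih (fun _ _ _ _ hc h1 h2 h3 => hh hc h1 h2 h3) rfl hx) hu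
    · exact ih hY (a := a + b₂) (by rw [← hi, ← hb]; abel) (hh hb₂ rfl hx hu)

theorem isGradedFamily_genFamily (g : A → Submodule K L) (S : Set A) :
    IsGradedFamily (genFamily g S) := by
  have key : ∀ ⦃a c i : A⦄ ⦃x u : L⦄, c ∈ S → a + c = i → x ∈ genFamily g S a → u ∈ g c →
      ⁅x, u⁆ ∈ genFamily g S i := by
    intro a c i x u hc hi hx hu
    exact lie_mem_of_mem_span_left
      (fun x hx => Submodule.subset_span (IsWord.snoc hx hc hu hi)) hx
  intro a b i x y hi hx hy
  exact bracket_genFamily_mem key (fun _ _ _ _ hc hi hx hu => key hc hi hx hu) hi hx hy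

theorem IsGradedFamily.bracket_genFamily_mem (hg : IsGradedFamily g) (hf : f ≤ g)
    {Y : Submodule K L} {i : A}
    (hY : ∀ ⦃a c : A⦄ ⦃x u : L⦄, c ∈ S → a + c = i → x ∈ g a → u ∈ f c → ⁅x, u⁆ ∈ Y)
    {a b : A} {x y : L} (hi : a + b = i) (hx : x ∈ g a) (hy : y ∈ genFamily f S b) :
    ⁅x, y⁆ ∈ Y :=
  _root_.bracket_genFamily_mem (h := g) (fun _ _ _ _ _ _ hi hx hu => hg hi hx (hf _ hu)) hY hi hx hy

/-- The derived series is bounded by the iterated derived families of a graded family spanning the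
algebra. -/
theorem derivedSeries_le_iSup_derivedIter (htop : ⨆ i, g i = ⊤) (k : ℕ) :
    (LieAlgebra.derivedSeries K L k).toSubmodule ≤ ⨆ i, derivedIter g k i := by
  induction k with
  | zero => simp [derivedIter, htop]
  | succ k ih =>
    rw [LieAlgebra.derivedSeries_def, LieAlgebra.derivedSeriesOfIdeal_succ,
      LieSubmodule.lieIdeal_oper_eq_linear_span', Submodule.span_le]
    rintro _ ⟨x, hx, y, hy, rfl⟩
    have hle : (⨆ i, derivedIter g k i) ≤
        Submodule.span K (⋃ i, (derivedIter g k i : Set L)) := by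
      rw [Submodule.span_iUnion]; simp
    refine lie_mem_of_mem_span ?_ (hle (ih hx)) (hle (ih hy))
    simp only [Set.mem_iUnion]
    rintro x ⟨a, hx⟩ y ⟨b, hy⟩
    exact Submodule.mem_iSup_of_mem (a + b) (derivedFamily_bracket_mem rfl hx hy)

end Families

/-! ### The relative form of Shalev's theorem -/

section Shalev

variable {K L : Type*} [CommRing K] [LieRing L] [LieAlgebra K L]

theorem genFamily_empty {A : Type*} [AddCommGroup A] (g : A → Submodule K L) (i : A) :
    genFamily g ∅ i = ⊥ := by
  refine Submodule.span_eq_bot.2 fun x hx => ?_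
  have hx : IsWord g ∅ i x := hx
  induction hx with
  | letter h _ => exact h.elim
  | snoc _ h _ _ _ => exact h.elim

theorem genFamily_le_of_forall {A : Type*} [AddCommGroup A] {g q : A → Submodule K L} {S : Set A}
    (hq : ∀ ⦃a b i : A⦄ ⦃x y : L⦄, a + b = i → x ∈ q a → b ∈ S → y ∈ g b → ⁅x, y⁆ ∈ q i)
    (hS : ∀ i ∈ S, g i ≤ q i) : genFamily g S ≤ q := by
  intro i
  refine Submodule.span_le.2 fun x hx => ?_
  replace hx : IsWord g S i x := hx
  induction hx with
  | letter h hx => exact hS _ h hx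
  | snoc _ hb hy hi ih => exact hq hi ih hb hy

section

variable {A : Type*} [AddCommGroup A] {g f h z : A → Submodule K L} {S : Set A}

theorem AbsorbsFamily.lie_mem' (hz : AbsorbsFamily z g) {a b i : A} {x y : L} (hi : a + b = i)
    (hx : x ∈ g a) (hy : y ∈ z b) : ⁅x, y⁆ ∈ z i := by
  rw [← lie_skew]
  exact Submodule.neg_mem _ (hz (by rw [← hi, add_comm]) hy hx)

theorem AbsorbsFamily.lie_mem_sup (hz : AbsorbsFamily z g) (hf : IsGradedFamily f) (hfg : f ≤ g)
    {a b i : A} {x y : L} (hi : a + b = i) (hx : x ∈ z a ⊔ f a) (hy : y ∈ z b ⊔ f b)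
    (hyg : y ∈ g b) : ⁅x, y⁆ ∈ z i ⊔ f i := by
  obtain ⟨u, hu, v, hv, rfl⟩ := Submodule.mem_sup.1 hx
  obtain ⟨s, hs, t, ht, rfl⟩ := Submodule.mem_sup.1 hy
  rw [add_lie, lie_add v]
  exact Submodule.add_mem _ (Submodule.mem_sup_left (hz hi hu hyg)) (Submodule.add_mem _
    (Submodule.mem_sup_left (hz.lie_mem' hi (hfg _ hv) hs)) (Submodule.mem_sup_right (hf hi hv ht)))

end

/-- The derived length in the relative form of Shalev's theorem, as a function of the number of
weights. -/
def shalevBound : ℕ → ℕ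
  | 0 => 0
  | r + 1 => 2 * shalevBound r + 1

theorem shalevBound_strictMono : StrictMono shalevBound :=
  strictMono_nat_of_lt_succ fun r => by rw [shalevBound]; omega

variable {n : ℕ} [NeZero n] {z : ZMod n → Submodule K L}

theorem ZMod.val_lt_val_of_add_eq {a j d : ZMod n} (h : a + j = d) (hd : d.val < j.val) :
    d.val < a.val := by
  have h1 := ZMod.val_add a j
  have h2 := ZMod.val_lt a
  have h3 := ZMod.val_lt j
  rw [h] at h1
  rcases lt_or_ge (a.val + j.val) n with h4 | h4
  · rw [Nat.mod_eq_of_lt h4] at h1; omega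
  · rw [Nat.mod_eq_sub_mod h4, Nat.mod_eq_of_lt (by omega)] at h1; omega

/-- One more weight is eliminated at each step, in the order of the representatives
`0, 1, …, n - 1`; only the weights in `W` cost anything. -/
theorem derivedIter_le_sup_genFamily (W : Finset (ZMod n)) (c : ℕ)
    (g : ZMod n → Submodule K L) (hg : IsGradedFamily g) (h0 : g 0 ≤ z 0)
    (hz : AbsorbsFamily z g) (hW : ∀ i ∉ W, g i ≤ z i) (i : ZMod n) :
    derivedIter g (shalevBound (W.filter fun w => w.val ≤ c).card) i ≤
      z i ⊔ genFamily g {j | c < j.val} i := by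
  induction c generalizing g i with
  | zero =>
    refine (hg.derivedIter_le _ i).trans ?_
    by_cases hi : i = 0
    · subst hi; exact h0.trans le_sup_left
    · refine le_trans ?_ le_sup_right
      exact le_genFamily (Nat.pos_of_ne_zero (by simpa [ZMod.val_eq_zero] using hi))
  | succ c ih =>
    have step : ∀ G : ZMod n → Submodule K L, G ≤ g →
        (∀ j : ZMod n, j.val = c + 1 → G j ≤ z j ⊔ genFamily g {j | c + 1 < j.val} j) →
        z ⊔ genFamily G {j | c < j.val} ≤ z ⊔ genFamily g {j | c + 1 < j.val} := by
      intro G hG hd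
      have hle : ∀ b, c < b.val → G b ≤ z b ⊔ genFamily g {j | c + 1 < j.val} b := by
        intro b hb
        rcases eq_or_lt_of_le (Nat.succ_le_of_lt hb) with h | h
        · exact hd b h.symm
        · have h2 : g b ≤ genFamily g {j | c + 1 < j.val} b := le_genFamily h
          exact (hG b).trans (h2.trans le_sup_right)
      refine sup_le le_sup_left (genFamily_le_of_forall (q := z ⊔ genFamily g {j | c + 1 < j.val})
        ?_ hle)
      intro a b i x y hi hx hb hy
      exact hz.lie_mem_sup (isGradedFamily_genFamily g _) (hg.genFamily_le _) hi hx (hle b hb hy)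
        (hG b hy)
    by_cases hd : ∃ d ∈ W, d.val = c + 1
    · obtain ⟨d, hdW, hdc⟩ := hd
      have hcard : (W.filter fun w => w.val ≤ c + 1).card =
          (W.filter fun w => w.val ≤ c).card + 1 := by
        rw [← Finset.card_insert_of_notMem (s := W.filter fun w => w.val ≤ c) (a := d)
          (by simp [hdc])]
        congr 1
        ext w
        simp only [Finset.mem_filter, Finset.mem_insert]
        constructor
        · rintro ⟨hw, h⟩
          rcases Nat.le_succ_iff.1 h with h | h
          · exact .inr ⟨hw, h⟩
          · exact .inl (ZMod.val_injective n (by omega))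
        · rintro (rfl | ⟨hw, h⟩)
          · exact ⟨hdW, by omega⟩
          · exact ⟨hw, by omega⟩
      set F := shalevBound (W.filter fun w => w.val ≤ c).card with hF
      set G := derivedIter g (F + 1) with hGdef
      have hGg : G ≤ g := hg.derivedIter_le _
      have hGd : G d ≤ z d ⊔ genFamily g {j | c + 1 < j.val} d := by
        refine derivedFamily_le fun a b x y hi hx hy => ?_
        have hxg := hg.derivedIter_le _ _ hx
        obtain ⟨s, hs, t, ht, rfl⟩ := Submodule.mem_sup.1 (ih g hg h0 hz hW b hy)
        rw [lie_add]
        refine Submodule.add_mem _ (Submodule.mem_sup_left (hz.lie_mem' hi hxg hs)) ?_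
        refine hg.bracket_genFamily_mem le_rfl ?_ hi hxg ht
        intro a' j x' u hj hi' hx' hu
        rcases eq_or_lt_of_le (Nat.succ_le_of_lt hj) with h | h
        · have hjd : j = d := ZMod.val_injective n (by omega)
          subst hjd
          have ha' : a' = 0 := by simpa using hi'
          subst ha'
          exact Submodule.mem_sup_left (hz hi' (h0 hx') hu)
        · refine Submodule.mem_sup_right (isGradedFamily_genFamily g _ hi' (le_genFamily ?_ hx')
            (le_genFamily ?_ hu))
          · have := ZMod.val_lt_val_of_add_eq hi' (by omega)
            change c + 1 < a'.val
            omega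
          · exact h
      have h1 := ih G (hg.derivedIter _) ((hGg 0).trans h0) (hz.mono hGg)
        (fun i hi => (hGg i).trans (hW i hi)) i
      rw [hGdef, derivedIter_derivedIter] at h1
      rw [hcard, shalevBound, ← hF, show 2 * F + 1 = F + 1 + F by ring]
      refine h1.trans (step G hGg ?_ i)
      intro j hj
      rw [show j = d from ZMod.val_injective n (by omega)]
      exact hGd
    · have hfil : (W.filter fun w => w.val ≤ c + 1) = W.filter fun w => w.val ≤ c := by
        refine Finset.filter_congr fun w hw => ⟨fun h => ?_, fun h => by omega⟩
        rcases Nat.le_succ_iff.1 h with h | h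
        · exact h
        · exact (hd ⟨w, hw, h⟩).elim
      rw [hfil]
      refine (ih g hg h0 hz hW i).trans (step g le_rfl ?_ i)
      intro j hj
      exact (hW j fun hjW => hd ⟨j, hjW, hj⟩).trans le_sup_left

/-- Relative form of Shalev's theorem on graded Lie algebras with few non-trivial components and
trivial zero component: here only the components of weight in `W` are not already contained in the
absorbing family `z`. -/
theorem derivedIter_shalevBound_le {g : ZMod n → Submodule K L} (hg : IsGradedFamily g)
    (h0 : g 0 ≤ z 0) (hz : AbsorbsFamily z g) {W : Finset (ZMod n)} (hW : ∀ i ∉ W, g i ≤ z i)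
    {r : ℕ} (hr : W.card ≤ r) : derivedIter g (shalevBound r) ≤ z := by
  intro i
  have h := derivedIter_le_sup_genFamily W n g hg h0 hz hW i
  have he : {j : ZMod n | n < j.val} = ∅ :=
    Set.eq_empty_of_forall_notMem fun j hj => (ZMod.val_lt j).not_gt hj
  rw [he, genFamily_empty, sup_bot_eq, Finset.filter_true_of_mem fun w _ => (ZMod.val_lt w).le] at h
  exact (hg.derivedIter_antitone (shalevBound_strictMono.monotone hr) i).trans h

-- the values are far too large to be evaluated
attribute [irreducible] shalevBound

end Shalev

/-! ### Words given by lists, and elimination of weights -/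

section ListWords

section Lists

variable {A L : Type*}

theorem List.exists_lt_count_of_subset [DecidableEq A] {l : List A} {Ω : Finset A} {m : ℕ}
    (h : ∀ a ∈ l, a ∈ Ω) (hl : Ω.card * m < l.length) : ∃ e ∈ l, m < l.count e := by
  have h1 := List.sum_toFinset_count_eq_length l
  have h2 : l.toFinset.card ≤ Ω.card := Finset.card_le_card fun a ha => h a (by simpa using ha)
  obtain ⟨e, he, hlt⟩ := Finset.exists_lt_of_sum_lt (s := l.toFinset) (f := fun _ => m)
    (g := fun a => l.count a) (by
      rw [h1, Finset.sum_const, smul_eq_mul]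
      exact (Nat.mul_le_mul_right m h2).trans_lt hl)
  exact ⟨e, by simpa using he, hlt⟩

theorem List.exists_perm_append_of_fst_eq [DecidableEq A] (l : List (A × L)) (e : A) :
    ∃ l₁ l₂, l.Perm (l₁ ++ l₂) ∧ (∀ p ∈ l₁, p.1 = e) ∧
      l₁.length = (l.map Prod.fst).count e := by
  refine ⟨l.filter fun p => p.1 = e, l.filter fun p => !decide (p.1 = e),
    (List.filter_append_perm _ _).symm, fun p hp => by simpa using (List.mem_filter.1 hp).2, ?_⟩
  rw [List.count, List.countP_map, List.countP_eq_length_filter]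
  congr 1

theorem List.sum_map_fst_of_forall_eq [AddCommMonoid A] {l : List (A × L)} {e : A}
    (h : ∀ p ∈ l, p.1 = e) : (l.map Prod.fst).sum = l.length • e := by
  rw [List.sum_eq_card_nsmul (l.map Prod.fst) e (by simpa using h), List.length_map]

end Lists

variable {K L A : Type*} [CommRing K] [LieRing L] [LieAlgebra K L]

/-- The left-normed bracket of `x` with the letters of a list; every letter carries its weight as
its first component. -/
def lieWord (x : L) (l : List (A × L)) : L :=
  l.foldl (fun z p => ⁅z, p.2⁆) x

@[simp] theorem lieWord_nil (x : L) : lieWord x ([] : List (A × L)) = x := rfl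

@[simp] theorem lieWord_cons (x : L) (p : A × L) (l : List (A × L)) :
    lieWord x (p :: l) = lieWord ⁅x, p.2⁆ l := rfl

theorem lieWord_append (x : L) (l₁ l₂ : List (A × L)) :
    lieWord x (l₁ ++ l₂) = lieWord (lieWord x l₁) l₂ := List.foldl_append

theorem lieWord_sub (x y : L) (l : List (A × L)) :
    lieWord (x - y) l = lieWord x l - lieWord y l := by
  induction l generalizing x y with
  | nil => rfl
  | cons p l ih => simp only [lieWord_cons, sub_lie, ih]

@[simp] theorem lieWord_zero (l : List (A × L)) : lieWord (0 : L) l = 0 := by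
  simpa using lieWord_sub (0 : L) 0 l

theorem lieWord_mem [AddCommGroup A] {g r : A → Submodule K L} (hgr : AbsorbsFamily g r)
    {l : List (A × L)} (hl : ∀ p ∈ l, p.2 ∈ r p.1) {a i : A} {x : L} (hx : x ∈ g a)
    (hi : a + (l.map Prod.fst).sum = i) : lieWord x l ∈ g i := by
  induction l generalizing a x with
  | nil => simpa [← hi] using hx
  | cons p l ih =>
    refine ih (fun q hq => hl q (List.mem_cons_of_mem _ hq))
      (hgr rfl hx (hl p List.mem_cons_self)) ?_
    rw [← hi, List.map_cons, List.sum_cons, add_assoc]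

/-- The letters of a word may be permuted modulo any submodule that contains all words obtained from
it by permuting its letters and replacing two adjacent ones by their bracket. -/
theorem lieWord_sub_mem_of_perm [Add A] {Y : Submodule K L} {l l' : List (A × L)} (h : l.Perm l')
    (x : L) (hY : ∀ l₁ p q l₂, (l₁ ++ p :: q :: l₂).Perm l →
      lieWord x (l₁ ++ (p.1 + q.1, ⁅p.2, q.2⁆) :: l₂) ∈ Y) :
    lieWord x l - lieWord x l' ∈ Y := by
  induction h generalizing x with
  | nil => simp
  | cons p _ ih => exact ih _ fun l₁ p' q' l₂ h => hY (p :: l₁) p' q' l₂ (h.cons p)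
  | swap p q l =>
    have h := hY [] q p l (.refl _)
    simp only [lieWord_cons, ← lieWord_sub]
    have e : ⁅⁅x, q.2⁆, p.2⁆ - ⁅⁅x, p.2⁆, q.2⁆ = ⁅x, ⁅q.2, p.2⁆⁆ := by
      rw [leibniz_lie x q.2 p.2, ← lie_skew q.2 ⁅x, p.2⁆]; abel
    rw [e]
    exact h
  | trans h₁ _ ih₁ ih₂ =>
    rw [← sub_add_sub_cancel]
    exact Submodule.add_mem _ (ih₁ x hY) (ih₂ x fun l₁ p q l₂ h => hY l₁ p q l₂ (h.trans h₁.symm))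

end ListWords

section Elimination

variable {K L : Type*} [CommRing K] [LieRing L] [LieAlgebra K L] {n : ℕ}

/-- Every arithmetic progression with non-zero difference leaves `D` within `m` steps. In
particular, `D` contains no coset of a non-trivial subgroup. -/
def AvoidsProgressions {A : Type*} [AddCommGroup A] (m : ℕ) (D : List A) : Prop :=
  ∀ a e : A, e ≠ 0 → ∃ j ≤ m, a + j • e ∉ D

/-- The lower chain from `g` to `B` under bracketing with `r`. -/
def lieChain {A : Type*} [AddCommGroup A] (g B r : A → Submodule K L) : ℕ → A → Submodule K L
  | 0 => g
  | j + 1 => fun i => B i ⊔ Submodule.span K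
      {z | ∃ a b x y, a + b = i ∧ x ∈ lieChain g B r j a ∧ y ∈ r b ∧ z = ⁅x, y⁆}

section Chain

variable {A : Type*} [AddCommGroup A] {g B r s : A → Submodule K L}

theorem lie_mem_lieChain_succ {j : ℕ} {a b i : A} {x y : L} (hi : a + b = i)
    (hx : x ∈ lieChain g B r j a) (hy : y ∈ r b) : ⁅x, y⁆ ∈ lieChain g B r (j + 1) i :=
  Submodule.mem_sup_right (Submodule.subset_span ⟨a, b, x, y, hi, hx, hy, rfl⟩)

theorem le_lieChain (hB : B ≤ g) : ∀ j, B ≤ lieChain g B r j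
  | 0 => hB
  | _ + 1 => fun _ => le_sup_left

theorem lieChain_le (hg : IsGradedFamily g) (hB : B ≤ g) (hr : r ≤ g) :
    ∀ j, lieChain g B r j ≤ g
  | 0 => le_rfl
  | j + 1 => fun i => by
    refine sup_le (hB i) (Submodule.span_le.2 ?_)
    rintro _ ⟨a, b, x, y, hi, hx, hy, rfl⟩
    exact hg hi (lieChain_le hg hB hr j a hx) (hr b hy)

theorem absorbsFamily_lieChain (hgs : AbsorbsFamily g s) (hBs : AbsorbsFamily B s)
    (hrs : AbsorbsFamily r s) : ∀ j, AbsorbsFamily (lieChain g B r j) s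
  | 0 => hgs
  | j + 1 => fun a b i x y hi hx hy => by
    obtain ⟨u, hu, v, hv, rfl⟩ := Submodule.mem_sup.1 hx
    rw [add_lie]
    refine Submodule.add_mem _ (Submodule.mem_sup_left (hBs hi hu hy)) ?_
    refine lie_mem_of_mem_span_left ?_ hv
    rintro _ ⟨a₁, b₁, x₁, y₁, ha, hx₁, hy₁, rfl⟩
    have e : ⁅⁅x₁, y₁⁆, y⁆ = ⁅x₁, ⁅y₁, y⁆⁆ + ⁅⁅x₁, y⁆, y₁⁆ := by
      rw [lie_lie x₁ y₁ y, ← lie_skew ⁅x₁, y⁆ y₁, sub_eq_add_neg]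
    rw [e]
    refine Submodule.add_mem _ ?_ ?_
    · exact lie_mem_lieChain_succ (a := a₁) (b := b₁ + b) (by rw [← hi, ← ha]; abel) hx₁
        (hrs rfl hy₁ hy)
    · exact lie_mem_lieChain_succ (a := a₁ + b) (b := b₁) (by rw [← hi, ← ha]; abel)
        (absorbsFamily_lieChain hgs hBs hrs j rfl hx₁ hy) hy₁

/-- Elements of the chain are words of the corresponding length modulo `B`. -/
theorem lieChain_le_sup_span (hBr : AbsorbsFamily B r) (j : ℕ) (i : A) :
    lieChain g B r j i ≤ B i ⊔ Submodule.span K {z | ∃ a x l, x ∈ g a ∧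
      (∀ p ∈ l, p.2 ∈ r p.1) ∧ l.length = j ∧ a + (l.map Prod.fst).sum = i ∧
      z = lieWord x l} := by
  induction j generalizing i with
  | zero =>
    refine le_trans ?_ le_sup_right
    intro x hx
    exact Submodule.subset_span ⟨i, x, [], hx, by simp, rfl, by simp, rfl⟩
  | succ j ih =>
    refine sup_le le_sup_left (Submodule.span_le.2 ?_)
    rintro _ ⟨a, b, x, y, hi, hx, hy, rfl⟩
    obtain ⟨u, hu, v, hv, rfl⟩ := Submodule.mem_sup.1 (ih a hx)
    rw [add_lie]
    refine Submodule.add_mem _ (Submodule.mem_sup_left (hBr hi hu hy))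
      (Submodule.mem_sup_right (lie_mem_of_mem_span_left ?_ hv))
    rintro _ ⟨a', x', l, hx', hl, hj, ha', rfl⟩
    refine Submodule.subset_span ⟨a', x', l ++ [(b, y)], hx', ?_, by simp [hj], ?_, ?_⟩
    · simp only [List.mem_append, List.mem_singleton]
      rintro p (hp | rfl)
      exacts [hl p hp, hy]
    · simp [← hi, ← ha', add_assoc]
    · simp [lieWord_append]

end Chain

section Nil

variable {g B : ZMod n → Submodule K L} {D : List (ZMod n)} {m : ℕ}

/-- The collecting step. A word in sufficiently many letters of `s` is pushed one step down the
chain of `r`, where `r` contains the brackets of `s` with itself. Modulo the next term of the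
chain the letters commute, so that either a letter whose weight is no difference of elements of
`D`, or many letters of the same weight may be moved to the front. In both cases a prefix lies in
`B`. -/
theorem lieWord_mem_lieChain_succ {r s : ZMod n → Submodule K L} (hg : IsGradedFamily g)
    (h0 : g 0 = ⊥) (hB : IsGradedFamily B) (hBg : B ≤ g) (hD : ∀ i ∉ D, g i ≤ B i)
    (hm : AvoidsProgressions m D) (hsB : s ≤ B) (hrs : AbsorbsFamily r s)
    (hsr : derivedFamily s ≤ r) {j : ℕ} {a i : ZMod n} {x : L} (hrB : r ≤ B)
    (hx : x ∈ lieChain g B r j a) {l : List (ZMod n × L)} (hl : ∀ p ∈ l, p.2 ∈ s p.1)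
    (hlen : D.length ^ 2 * m < l.length) (hi : a + (l.map Prod.fst).sum = i) :
    lieWord x l ∈ lieChain g B r (j + 1) i := by
  have hsg : s ≤ g := hsB.trans hBg
  have hgs : AbsorbsFamily g s := fun a b i x y hi hx hy => hg hi hx (hsg _ hy)
  have hBs : AbsorbsFamily B s := fun a b i x y hi hx hy => hB hi hx (hsB _ hy)
  have hxg : x ∈ g a := lieChain_le hg hBg (hrB.trans hBg) j a hx
  have hch : ∀ j, AbsorbsFamily (lieChain g B r j) s := absorbsFamily_lieChain hgs hBs hrs
  -- the letters may be permuted modulo the next term of the chain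
  have hperm : ∀ l' : List (ZMod n × L), l.Perm l' → lieWord x l' ∈ lieChain g B r (j + 1) i →
      lieWord x l ∈ lieChain g B r (j + 1) i := by
    intro l' hll' hl'
    have h := lieWord_sub_mem_of_perm (Y := lieChain g B r (j + 1) i) hll' x ?_
    · simpa using Submodule.add_mem _ h hl'
    · intro l₁ p q l₂ hp
      have hs : ∀ p' ∈ l₁ ++ p :: q :: l₂, p'.2 ∈ s p'.1 := fun p' hp' => hl p' (hp.mem_iff.1 hp')
      have hsum := (hp.map Prod.fst).sum_eq
      simp only [List.map_append, List.map_cons, List.sum_append, List.sum_cons] at hsum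
      rw [lieWord_append, lieWord_cons]
      refine lieWord_mem (hch (j + 1)) (fun p' hp' => hs p' (by simp [hp'])) (a := a +
        (l₁.map Prod.fst).sum + (p.1 + q.1)) (lie_mem_lieChain_succ rfl (lieWord_mem (hch j)
          (fun p' hp' => hs p' (by simp [hp'])) hx rfl) ?_) ?_
      · exact hsr _ (derivedFamily_bracket_mem rfl (hs p (by simp)) (hs q (by simp)))
      · rw [← hi, ← hsum]; abel
  -- prefixes with values in `B` suffice
  have hfront : ∀ l₁ l₂ : List (ZMod n × L), l.Perm (l₁ ++ l₂) →
      lieWord x l₁ ∈ B (a + (l₁.map Prod.fst).sum) →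
      lieWord x l ∈ lieChain g B r (j + 1) i := by
    intro l₁ l₂ hp h
    refine hperm _ hp (le_lieChain hBg _ _ ?_)
    rw [lieWord_append]
    refine lieWord_mem hBs (fun p' hp' => hl p' (hp.mem_iff.2 (by simp [hp']))) h ?_
    have hsum := (hp.map Prod.fst).sum_eq
    rw [List.map_append, List.sum_append] at hsum
    rw [← hi, hsum, add_assoc]
  classical
  by_cases hΩ : ∀ p ∈ l, p.1 ≠ 0 ∧
      p.1 ∈ (D.toFinset ×ˢ D.toFinset).image fun p => p.1 - p.2
  · obtain ⟨e, he, hcount⟩ := List.exists_lt_count_of_subset (l := l.map Prod.fst)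
      (Ω := (D.toFinset ×ˢ D.toFinset).image fun p => p.1 - p.2) (m := m)
      (by simpa using fun a b hab => (hΩ (a, b) hab).2) (by
        rw [List.length_map]
        refine lt_of_le_of_lt (Nat.mul_le_mul_right m ?_) hlen
        refine Finset.card_image_le.trans ?_
        rw [Finset.card_product, sq]
        exact Nat.mul_le_mul D.toFinset_card_le D.toFinset_card_le)
    obtain ⟨p, hp, rfl⟩ := List.mem_map.1 he
    obtain ⟨l₁, l₂, hperm', hl₁, hlen₁⟩ := List.exists_perm_append_of_fst_eq l p.1
    obtain ⟨k, hk, hkD⟩ := hm a p.1 (hΩ p hp).1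
    have hklen : (l₁.take k).length = k := by rw [List.length_take]; omega
    refine hfront (l₁.take k) (l₁.drop k ++ l₂) (by
      rw [← List.append_assoc, List.take_append_drop]; exact hperm') (hD _ ?_ ?_)
    · rw [List.sum_map_fst_of_forall_eq fun q hq => hl₁ q (List.mem_of_mem_take hq), hklen]
      exact hkD
    · exact lieWord_mem hgs (fun q hq => hl q (hperm'.mem_iff.2
        (List.mem_append_left _ (List.mem_of_mem_take hq)))) hxg rfl
  · push Not at hΩ
    obtain ⟨p, hp, hpΩ⟩ := hΩ
    have hps := hl p hp
    obtain ⟨l₁, l₂, rfl⟩ := List.append_of_mem hp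
    refine hfront [p] (l₁ ++ l₂) List.perm_middle ?_
    simp only [List.map_cons, List.map_nil, List.sum_cons, List.sum_nil, add_zero, lieWord_cons,
      lieWord_nil]
    by_cases hp0 : p.1 = 0
    · have : p.2 = 0 := by simpa [hp0, h0] using hsg _ hps
      rw [this, lie_zero]
      exact zero_mem _
    · by_cases haD : a ∈ D
      · refine hD _ (fun hapD => hpΩ hp0 ?_) (hg rfl hxg (hsg _ hps))
        exact Finset.mem_image.2 ⟨(a + p.1, a), by simp [haD, hapD], by simp⟩
      · exact hB rfl (hD a haD hxg) (hsB _ hps)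

/-- The elements of `B` which multiply the whole of `g` into `B`. -/
def lieIdealizer {A : Type*} [AddCommGroup A] (g B : A → Submodule K L) (e : A) :
    Submodule K L where
  carrier := {x | x ∈ B e ∧ ∀ a y, y ∈ g a → ⁅y, x⁆ ∈ B (a + e)}
  add_mem' := by
    rintro x x' ⟨h₁, h₂⟩ ⟨h₁', h₂'⟩
    refine ⟨Submodule.add_mem _ h₁ h₁', fun a y hy => ?_⟩
    rw [lie_add]
    exact Submodule.add_mem _ (h₂ a y hy) (h₂' a y hy)
  zero_mem' := ⟨zero_mem _, fun a y _ => by rw [lie_zero]; exact zero_mem _⟩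
  smul_mem' := by
    rintro c x ⟨h₁, h₂⟩
    refine ⟨Submodule.smul_mem _ c h₁, fun a y hy => ?_⟩
    rw [lie_smul]
    exact Submodule.smul_mem _ c (h₂ a y hy)

theorem absorbsFamily_lieIdealizer {A : Type*} [AddCommGroup A] {g B : A → Submodule K L}
    (hg : IsGradedFamily g) (hB : IsGradedFamily B) (hBg : B ≤ g) :
    AbsorbsFamily (lieIdealizer g B) B := by
  rintro a b i x y hi ⟨hx, hxg⟩ hy
  refine ⟨hB hi hx hy, fun c u hu => ?_⟩
  have e : ⁅u, ⁅x, y⁆⁆ = ⁅⁅u, x⁆, y⁆ - ⁅⁅u, y⁆, x⁆ := by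
    rw [leibniz_lie u x y, ← lie_skew x ⁅u, y⁆]; abel
  rw [e]
  refine Submodule.sub_mem _ (hB (by rw [← hi, add_assoc]) (hxg c u hu) hy) ?_
  have h := hxg (c + b) _ (hg rfl hu (hBg _ hy))
  rwa [show c + b + a = c + i by rw [← hi]; abel] at h

/-- The length of the chain from `g` down to a subalgebra containing all components whose weight is
outside a set of `r` weights leaving no room for long progressions. -/
def nilBound (m r : ℕ) : ℕ :=
  (r ^ 2 * m + 1) ^ shalevBound (r ^ 2)

/-- Passing from the `(k + 1)`-st to the `k`-th derived family of `B` multiplies the length of the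
chain by a bounded factor. -/
theorem lieChain_derivedIter_le (hg : IsGradedFamily g) (h0 : g 0 = ⊥) (hB : IsGradedFamily B)
    (hBg : B ≤ g) (hD : ∀ i ∉ D, g i ≤ B i) (hm : AvoidsProgressions m D) {k N : ℕ}
    (hN : lieChain g B (derivedIter B (k + 1)) N ≤ B) :
    lieChain g B (derivedIter B k) ((D.length ^ 2 * m + 1) * N) ≤ B := by
  set M := D.length ^ 2 * m + 1 with hM
  set s := derivedIter B k with hs
  set r := derivedIter B (k + 1) with hr
  have hsB : s ≤ B := hB.derivedIter_le k
  have hrB : r ≤ B := hB.derivedIter_le (k + 1)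
  have hrs : AbsorbsFamily r s := (hB.absorbsFamily_derivedIter (k + 1)).mono hsB
  have hBs : AbsorbsFamily B s := fun a b i x y hi hx hy => hB hi hx (hsB _ hy)
  have key : ∀ j, ∀ l : List (ZMod n × L), (∀ p ∈ l, p.2 ∈ s p.1) → l.length = M * j →
      ∀ a i x, x ∈ g a → a + (l.map Prod.fst).sum = i → lieWord x l ∈ lieChain g B r j i := by
    intro j
    induction j with
    | zero =>
      intro l _ hlen a i x hx hi
      obtain rfl : l = [] := List.length_eq_zero_iff.1 (by simpa using hlen)
      simpa [← hi, lieChain] using hx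
    | succ j ih =>
      intro l hl hlen a i x hx hi
      have hlen' : l.length = M * j + M := by rw [hlen]; ring
      rw [← List.take_append_drop (M * j) l, lieWord_append]
      refine lieWord_mem_lieChain_succ hg h0 hB hBg hD hm hsB hrs (j := j)
        (by rw [hs, hr]; exact le_rfl) hrB
        (ih (l.take (M * j)) (fun p hp => hl p (List.mem_of_mem_take hp)) (by
          rw [List.length_take]; omega) a _ x hx rfl)
        (fun p hp => hl p (List.mem_of_mem_drop hp)) (by rw [List.length_drop]; omega) ?_
      rw [← hi, add_assoc, ← List.sum_append, ← List.map_append, List.take_append_drop]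
  intro i
  refine (lieChain_le_sup_span hBs _ i).trans (sup_le le_rfl (Submodule.span_le.2 ?_))
  rintro _ ⟨a, x, l, hx, hl, hlen, hi, rfl⟩
  exact hN i (key N l hl hlen a i x hx hi)

/-- Bracketing `g` boundedly often with a subalgebra `B` containing all components of weight outside
`D` leads into `B`. -/
theorem lieChain_nilBound_le [NeZero n] (hg : IsGradedFamily g) (h0 : g 0 = ⊥)
    (hB : IsGradedFamily B) (hBg : B ≤ g) (hD : ∀ i ∉ D, g i ≤ B i)
    (hm : AvoidsProgressions m D) : lieChain g B B (nilBound m D.length) ≤ B := by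
  classical
  have hk : derivedIter B (shalevBound (D.length ^ 2)) ≤ lieIdealizer g B := by
    refine derivedIter_shalevBound_le hB ?_ (absorbsFamily_lieIdealizer hg hB hBg)
      (W := (D.toFinset ×ˢ D.toFinset).image fun p => p.1 - p.2) ?_ ?_
    · exact le_trans (hBg 0) (by simp [h0])
    · intro e he x hx
      refine ⟨hx, fun a y hy => ?_⟩
      by_cases haD : a ∈ D
      · refine hD _ (fun hapD => he ?_) (hg rfl hy (hBg _ hx))
        exact Finset.mem_image.2 ⟨(a + e, a), by simp [haD, hapD], by simp⟩
      · exact hB rfl (hD a haD hy) hx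
    · refine Finset.card_image_le.trans ?_
      rw [Finset.card_product, sq]
      exact Nat.mul_le_mul D.toFinset_card_le D.toFinset_card_le
  have h : ∀ c ≤ shalevBound (D.length ^ 2),
      lieChain g B (derivedIter B (shalevBound (D.length ^ 2) - c))
        ((D.length ^ 2 * m + 1) ^ c) ≤ B := by
    intro c
    induction c with
    | zero =>
      intro _ i
      refine sup_le le_rfl (Submodule.span_le.2 ?_)
      rintro _ ⟨a, b, x, y, rfl, hx, hy, rfl⟩
      exact (hk b hy).2 a x hx
    | succ c ih =>
      intro hc
      rw [pow_succ' (D.length ^ 2 * m + 1) c]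
      refine lieChain_derivedIter_le hg h0 hB hBg hD hm ?_
      rw [show shalevBound (D.length ^ 2) - (c + 1) + 1 = shalevBound (D.length ^ 2) - c by omega]
      exact ih (by omega)
  have h' := h _ le_rfl
  rwa [Nat.sub_self] at h'

/-- A list of weights, the last one first, that can be eliminated one after the other: the sum of a
weight with itself or with an earlier one is not in the list up to that point, and long progressions
leave the list. -/
def EliminationOrder {A : Type*} [AddCommGroup A] (m : ℕ) : List A → Prop
  | [] => True
  | d :: D => (∀ h ∈ d :: D, d + h ∉ d :: D) ∧ AvoidsProgressions m (d :: D) ∧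
      EliminationOrder m D

/-- The derived length needed to eliminate `r` weights. -/
def eliminationBound (m : ℕ) : ℕ → ℕ
  | 0 => 0
  | r + 1 => (eliminationBound m r + 1) * nilBound m (r + 1)

/-- A bounded term of the derived series lies in the subalgebra generated by the components whose
weights are not in the list. -/
theorem EliminationOrder.derivedIter_le [NeZero n] {D : List (ZMod n)}
    (hD : EliminationOrder m D) {g : ZMod n → Submodule K L} (hg : IsGradedFamily g)
    (h0 : g 0 = ⊥) :
    derivedIter g (eliminationBound m D.length) ≤ genFamily g {i | i ∉ D} := by
  induction D generalizing g with
  | nil => exact fun i => le_genFamily (by simp)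
  | cons d D ih =>
    obtain ⟨hdD, hm, hD⟩ := hD
    set k := eliminationBound m D.length with hk
    set B := genFamily g {i | i ∉ d :: D} with hBdef
    have hB : IsGradedFamily B := isGradedFamily_genFamily _ _
    have hBg : B ≤ g := hg.genFamily_le _
    have hDB : ∀ i ∉ d :: D, g i ≤ B i := fun i hi => le_genFamily hi
    have key : ∀ j, derivedIter g ((k + 1) * j) ≤ lieChain g B B j := by
      intro j
      induction j with
      | zero => exact le_rfl
      | succ j ihj =>
        rw [mul_add, mul_one, ← derivedIter_derivedIter]
        set G := derivedIter g ((k + 1) * j) with hG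
        have hGg : G ≤ g := hg.derivedIter_le _
        have hGG : IsGradedFamily G := hg.derivedIter _
        intro i
        refine derivedFamily_le fun a b x y hi hx hy => ?_
        refine hGG.bracket_genFamily_mem le_rfl (S := {i | i ∉ D}) ?_ hi
          (hGG.derivedIter_le k a hx)
          (ih hD hGG (le_bot_iff.1 (h0 ▸ hGg 0)) b hy)
        intro a c x u hc hi hx hu
        by_cases hcd : c = d
        · subst hcd
          -- if the weight of `x` is not in the list, `x` takes over the role of the letter
          by_cases haD : a ∈ c :: D
          · refine le_lieChain hBg _ _ (hDB i ?_ (hg hi (hGg _ hx) (hGg _ hu)))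
            rw [← hi, add_comm]
            exact hdD a haD
          · rw [← lie_skew]
            exact Submodule.neg_mem _ (lie_mem_lieChain_succ (by rw [← hi, add_comm])
              (ihj _ hu) (hDB a haD (hGg _ hx)))
        · refine lie_mem_lieChain_succ hi (ihj _ hx) (hDB c ?_ (hGg _ hu))
          simpa [hcd] using hc
    have hN := lieChain_nilBound_le hg h0 hB hBg hDB hm
    rw [List.length_cons] at hN ⊢
    rw [eliminationBound, ← hk]
    generalize nilBound m (D.length + 1) = N at hN
    exact (key N).trans hN

-- the values are far too large to be evaluated
attribute [irreducible] nilBound eliminationBound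

end Nil

end Elimination

/-! ### Checking elimination orders on coefficient vectors -/

section Coefficients

variable {A : Type*} [AddCommGroup A]

/-- The integer combination of three fixed weights with a given vector of coefficients. -/
def evalCoeff (x y z : A) (v : ℤ × ℤ × ℤ) : A := v.1 • x + v.2.1 • y + v.2.2 • z

theorem evalCoeff_add (x y z : A) (v w : ℤ × ℤ × ℤ) :
    evalCoeff x y z (v + w) = evalCoeff x y z v + evalCoeff x y z w := by
  simp only [evalCoeff, Prod.fst_add, Prod.snd_add, add_smul]; abel

theorem evalCoeff_sub (x y z : A) (v w : ℤ × ℤ × ℤ) :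
    evalCoeff x y z (v - w) = evalCoeff x y z v - evalCoeff x y z w := by
  simp only [evalCoeff, Prod.fst_sub, Prod.snd_sub, sub_smul]; abel

theorem evalCoeff_nsmul (x y z : A) (o : ℕ) (v : ℤ × ℤ × ℤ) :
    evalCoeff x y z (o • v) = o • evalCoeff x y z v := by
  simp only [evalCoeff, Prod.smul_fst, Prod.smul_snd, smul_add, smul_assoc]

/-- The requirement of an elimination order that the sum of a weight with itself or an earlier
weight is not in the list, tested on vectors of coefficients: `good` recognizes vectors known not to
vanish. -/
def levelCheck (good : ℤ × ℤ × ℤ → Bool) : List (ℤ × ℤ × ℤ) → Bool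
  | [] => true
  | d :: D => ((d :: D).all fun h => (d :: D).all fun h' => good (d + h - h')) &&
      levelCheck good D

/-- All multiples up to the `m`-th of a difference of vectors from two different classes are
recognized as non-zero. -/
def mixingCheck (good : ℤ × ℤ × ℤ → Bool) (m : ℕ) (C C' : List (ℤ × ℤ × ℤ)) : Bool :=
  C.all fun c => C'.all fun c' => (List.range m).all fun o => good ((o + 1) • (c - c'))

theorem AvoidsProgressions.mono {m : ℕ} {D D' : List A} (h : AvoidsProgressions m D')
    (hD : D ⊆ D') : AvoidsProgressions m D := fun a e he => by
  obtain ⟨j, hj, hj'⟩ := h a e he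
  exact ⟨j, hj, fun h => hj' (hD h)⟩

theorem eliminationOrder_of_levelCheck {x y z : A} {good : ℤ × ℤ × ℤ → Bool}
    (hgood : ∀ v, good v → evalCoeff x y z v ≠ 0) {m : ℕ} {D : List (ℤ × ℤ × ℤ)}
    (hD : AvoidsProgressions m (D.map (evalCoeff x y z))) (hc : levelCheck good D) :
    EliminationOrder m (D.map (evalCoeff x y z)) := by
  induction D with
  | nil => trivial
  | cons d D ih =>
    rw [levelCheck, Bool.and_eq_true] at hc
    refine ⟨?_, hD, ih (hD.mono (List.subset_cons_self _ _)) hc.2⟩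
    have h1 := hc.1
    simp only [List.all_eq_true] at h1
    rw [← List.map_cons]
    intro h hh hmem
    obtain ⟨v, hv, rfl⟩ := List.mem_map.1 hh
    obtain ⟨w, hw, he⟩ := List.mem_map.1 hmem
    refine hgood _ (h1 v hv w hw) ?_
    rw [evalCoeff_sub, evalCoeff_add, he, sub_self]

theorem exists_nsmul_eq_zero_of_forall_mem {D : List A} {m : ℕ} (hlen : D.length ≤ m) {a e : A}
    (h : ∀ j ≤ m, a + j • e ∈ D) : ∃ o, 1 ≤ o ∧ o ≤ m ∧ o • e = 0 := by
  classical
  obtain ⟨i, hi, j, hj, hij, he⟩ := Finset.exists_ne_map_eq_of_card_lt_of_maps_to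
    (s := Finset.range (m + 1)) (t := D.toFinset) (f := fun j => a + j • e)
    (by rw [Finset.card_range]; exact Nat.lt_succ_of_le (D.toFinset_card_le.trans hlen))
    (fun j hj => by simpa using h j (by simpa [Nat.lt_succ_iff] using hj))
  rw [Finset.mem_range] at hi hj
  have he : i • e = j • e := add_left_cancel he
  rcases lt_or_gt_of_ne hij with h' | h'
  · exact ⟨j - i, by omega, by omega, by rw [sub_nsmul _ h'.le, he, add_neg_cancel]⟩
  · exact ⟨i - j, by omega, by omega, by rw [sub_nsmul _ h'.le, he, add_neg_cancel]⟩

/-- A long progression in a union of classes has a difference of small order, hence cannot pass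
from one class to another. -/
theorem avoidsProgressions_flatten {m : ℕ} {Cs : List (List A)}
    (hlen : Cs.flatten.length ≤ m) (hC : ∀ C ∈ Cs, AvoidsProgressions m C)
    (hmix : Cs.Pairwise fun C C' => ∀ c ∈ C, ∀ c' ∈ C', ∀ o, 1 ≤ o → o ≤ m → o • (c - c') ≠ 0) :
    AvoidsProgressions m Cs.flatten := by
  intro a e he
  by_contra! h
  obtain ⟨o, ho1, hom, hoe⟩ := exists_nsmul_eq_zero_of_forall_mem hlen h
  have hmix' : ∀ C ∈ Cs, ∀ C' ∈ Cs, ∀ b, b ∈ C → b + e ∈ C' → C = C' := by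
    intro C hC C' hC' b hb hb'
    by_contra hne
    have hsymm : Std.Symm fun C C' : List A => ∀ c ∈ C, ∀ c' ∈ C', ∀ o, 1 ≤ o → o ≤ m →
        o • (c - c') ≠ 0 := ⟨fun C C' h c hc c' hc' o h1 h2 h3 => h c' hc' c hc o h1 h2 (by
      rw [← neg_sub, smul_neg, h3, neg_zero])⟩
    refine hmix.forall hC' hC (Ne.symm hne) _ hb' _ hb o ho1 hom ?_
    rw [add_sub_cancel_left, hoe]
  have h0 := h 0 (Nat.zero_le _)
  rw [zero_nsmul, add_zero] at h0
  obtain ⟨C, hCs, haC⟩ := List.mem_flatten.1 h0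
  have hall : ∀ j ≤ m, a + j • e ∈ C := by
    intro j
    induction j with
    | zero => simpa using haC
    | succ j ih =>
      intro hj
      obtain ⟨C', hC', hj'⟩ := List.mem_flatten.1 (h (j + 1) hj)
      rw [succ_nsmul, ← add_assoc] at hj'
      rw [hmix' C hCs C' hC' _ (ih (by omega)) hj', succ_nsmul, ← add_assoc]
      exact hj'
  obtain ⟨j, hj, hj'⟩ := hC C hCs a e he
  exact hj' (hall j hj)

theorem avoidsProgressions_pair {m : ℕ} (hm : 2 ≤ m) (h2 : ∀ e : A, e + e = 0 → e = 0) (u v : A) :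
    AvoidsProgressions m [u, v] := by
  intro a e he
  by_contra! h
  have h0 := h 0 (by omega)
  have h1 := h 1 (by omega)
  have h2' := h 2 (by omega)
  have he2 : e + e ≠ 0 := fun h => he (h2 e h)
  have k01 : a + e ≠ a := by simpa using he
  have k02 : a + (e + e) ≠ a := by simpa using he2
  have k12 : a + (e + e) ≠ a + e := by simpa using he
  simp only [zero_nsmul, add_zero, one_nsmul, two_nsmul, List.mem_cons, List.not_mem_nil,
    or_false] at h0 h1 h2'
  rcases h0 with h0 | h0 <;> rcases h1 with h1 | h1 <;>
    first
    | exact absurd (h1.trans h0.symm) k01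
    | (rcases h2' with h2' | h2' <;>
        first
        | exact absurd (h2'.trans h0.symm) k02
        | exact absurd (h2'.trans h1.symm) k12)

/-- A long progression inside three weights `u, v, w` runs through all of them with `3 e = 0`,
so that `3 u = u + v + w`. -/
theorem avoidsProgressions_triple {m : ℕ} (hm : 3 ≤ m) (h2 : ∀ e : A, e + e = 0 → e = 0)
    {u v w : A} (huvw : u + u ≠ v + w) : AvoidsProgressions m [u, v, w] := by
  intro a e he
  by_contra! h
  have h0 := h 0 (by omega)
  have h1 := h 1 (by omega)
  have h2' := h 2 (by omega)
  have h3 := h 3 (by omega)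
  have he2 : e + e ≠ 0 := fun h => he (h2 e h)
  have k01 : a + e ≠ a := by simpa using he
  have k02 : a + (e + e) ≠ a := by simpa using he2
  have k12 : a + (e + e) ≠ a + e := by simpa using he
  have k13 : a + (e + e + e) ≠ a + e := by
    intro h; apply he2; rw [add_right_inj, add_assoc] at h; simpa using h
  have k23 : a + (e + e + e) ≠ a + (e + e) := by simpa using he
  have e3 : (3 : ℕ) • e = e + e + e := by rw [succ_nsmul, two_nsmul]
  rw [e3] at h3
  simp only [zero_nsmul, add_zero, one_nsmul, two_nsmul, List.mem_cons, List.not_mem_nil,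
    or_false] at h0 h1 h2' h3
  have h30 : a + (e + e + e) = a := by
    rcases h0 with h0 | h0 | h0 <;> rcases h1 with h1 | h1 | h1 <;>
    first
    | exact absurd (h1.trans h0.symm) k01
    | (rcases h2' with h2' | h2' | h2' <;>
        first
        | exact absurd (h2'.trans h0.symm) k02
        | exact absurd (h2'.trans h1.symm) k12
        | (rcases h3 with h3 | h3 | h3 <;>
            first
            | exact absurd (h3.trans h1.symm) k13
            | exact absurd (h3.trans h2'.symm) k23
            | exact h3.trans h0.symm))
  have e0 : e + e + e = 0 := by simpa using h30
  -- the three terms exhaust the list, and three times each of them is their sum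
  rcases h0 with h0 | h0 | h0 <;> rcases h1 with h1 | h1 | h1 <;>
    first
    | exact absurd (h1.trans h0.symm) k01
    | (rcases h2' with h2' | h2' | h2' <;>
        first
        | exact absurd (h2'.trans h0.symm) k02
        | exact absurd (h2'.trans h1.symm) k12
        | (apply huvw
           rw [← h0, ← h1, ← h2', ← sub_eq_zero]
           first
           | abel1
           | exact (by abel1 : _ = e + e + e).trans e0
           | exact (by abel1 : _ = -(e + e + e)).trans (by rw [e0, neg_zero])))

end Coefficients

/-! ### The elimination orders in use -/

section Orders

variable {A : Type*} [AddCommGroup A]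

theorem avoidsProgressions_of_mixingCheck {x y z : A} {good : ℤ × ℤ × ℤ → Bool}
    (hgood : ∀ v, good v → evalCoeff x y z v ≠ 0) {m : ℕ} {Cs : List (List (ℤ × ℤ × ℤ))}
    (hCs : Cs.Pairwise fun C C' => mixingCheck good m C C' = true) (hlen : Cs.flatten.length ≤ m)
    (hC : ∀ C ∈ Cs, AvoidsProgressions m (C.map (evalCoeff x y z))) {D : List (ℤ × ℤ × ℤ)}
    (hD : D ⊆ Cs.flatten) : AvoidsProgressions m (D.map (evalCoeff x y z)) := by
  have h := avoidsProgressions_flatten (m := m) (Cs := Cs.map (List.map (evalCoeff x y z)))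
    (by rwa [← List.map_flatten, List.length_map]) (by simpa using hC) ?_
  · rw [← List.map_flatten] at h
    exact h.mono (List.map_subset _ hD)
  · refine hCs.map _ fun C C' h => ?_
    intro c hc c' hc' o h1 hom
    obtain ⟨v, hv, rfl⟩ := List.mem_map.1 hc
    obtain ⟨w, hw, rfl⟩ := List.mem_map.1 hc'
    simp only [mixingCheck, List.all_eq_true, List.mem_range] at h
    have := hgood _ (h v hv w hw (o - 1) (by omega))
    rwa [Nat.sub_add_cancel h1, evalCoeff_nsmul, evalCoeff_sub] at this

/-- No small non-zero multiple of `t` is a small combination of `a` and `b`. -/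
def IsGenericWeight (a b t : A) : Prop :=
  ∀ o α β : ℤ, o ≠ 0 → o.natAbs ≤ 6 → α.natAbs ≤ 12 → β.natAbs ≤ 12 →
    o • t + α • a + β • b ≠ 0

/-- No small non-zero multiple of `a` is a small multiple of `t`, and `t` has no small order. -/
def IsGenericShift (a t : A) : Prop :=
  ∀ o β : ℤ, o ≠ 0 ∨ β ≠ 0 → o.natAbs ≤ 12 → β.natAbs ≤ 18 → o • a + β • t ≠ 0

/-- The list consists of `-b, -a, -(a + b)` and their reflections under `j ↦ t - j`. The classes of
the progression argument are these two triples; elements of different triples differ by a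
combination in which `t` has coefficient `±1`. -/
theorem eliminationOrder_of_isGenericWeight (h2 : ∀ e : A, e + e = 0 → e = 0) {a b t : A}
    (ht : IsGenericWeight a b t) (ha : a ≠ 0) (hb : b ≠ 0) (hab : a + b ≠ 0) (h2ab : a + a ≠ b)
    (hab2 : a + (b + b) ≠ 0) (haab : a + a + b ≠ 0) :
    EliminationOrder 6 [t + b, t + a, t + (a + b), -(a + b), -a, -b] := by
  -- the combinations of `a` and `b` that are non-zero by hypothesis, and doubles of such
  set base : List (ℤ × ℤ × ℤ) := [(0, 1, 0), (0, 0, 1), (0, 1, 1), (0, 2, 0), (0, 0, 2), (0, 2, 2),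
    (0, 2, -1), (0, 1, 2), (0, 2, 1)] with hbase
  set good : ℤ × ℤ × ℤ → Bool := fun v => (v.1 ≠ 0 && v.1.natAbs ≤ 6 && v.2.1.natAbs ≤ 12 &&
    v.2.2.natAbs ≤ 12) || v ∈ base || -v ∈ base with hgooddef
  have hbase' : ∀ v ∈ base, evalCoeff t a b v ≠ 0 := by
    have ha2 : a + a ≠ 0 := fun h => ha (h2 a h)
    have hb2 : b + b ≠ 0 := fun h => hb (h2 b h)
    have hab2' : a + a + (b + b) ≠ 0 := fun h => hab (h2 _ (by rw [← h]; abel))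
    have h2ab' : a + a + -b ≠ 0 := fun h => h2ab (by rwa [← sub_eq_add_neg, sub_eq_zero] at h)
    simp only [hbase, List.forall_mem_cons, List.not_mem_nil, false_imp_iff, implies_true, and_true,
      evalCoeff, zero_smul, one_smul, two_smul, neg_smul, zero_add, add_zero]
    exact ⟨ha, hb, hab, ha2, hb2, hab2', h2ab', hab2, haab⟩
  have hgood : ∀ v, good v → evalCoeff t a b v ≠ 0 := by
    intro v hv
    simp only [hgooddef, Bool.or_eq_true, Bool.and_eq_true, decide_eq_true_eq] at hv
    rcases hv with (⟨⟨⟨h1, h2⟩, h3⟩, h4⟩ | h) | h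
    · exact ht _ _ _ h1 h2 h3 h4
    · exact hbase' v h
    · have := hbase' _ h
      have e := evalCoeff_sub t a b 0 v
      rw [zero_sub] at e
      intro h0
      apply this
      rw [e, h0, sub_zero]
      simp [evalCoeff]
  have hmap : [t + b, t + a, t + (a + b), -(a + b), -a, -b] =
      [(1, 0, 1), (1, 1, 0), (1, 1, 1), (0, -1, -1), (0, -1, 0), (0, 0, -1)].map
        (evalCoeff t a b) := by
    simp [evalCoeff, add_left_comm, add_comm]
  have hC : ∀ C ∈ [[(1, 1, 1), (1, 1, 0), (1, 0, 1)], [(0, -1, -1), (0, -1, 0), (0, 0, -1)]],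
      AvoidsProgressions 6 (C.map (evalCoeff t a b)) := by
    simp only [List.forall_mem_cons, List.not_mem_nil, false_imp_iff, implies_true, and_true,
      List.map_cons, List.map_nil]
    refine ⟨avoidsProgressions_triple (by norm_num) h2 ?_,
      avoidsProgressions_triple (by norm_num) h2 ?_⟩ <;>
    · rw [← evalCoeff_add, ← evalCoeff_add, Ne, ← sub_eq_zero, ← evalCoeff_sub]
      exact hgood _ (by decide)
  rw [hmap]
  refine eliminationOrder_of_levelCheck hgood (avoidsProgressions_of_mixingCheck hgood (Cs :=
    [[(1, 1, 1), (1, 1, 0), (1, 0, 1)], [(0, -1, -1), (0, -1, 0), (0, 0, -1)]]) ?_ (by simp)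
    hC (by simp)) ?_
  · decide +kernel
  · decide +kernel

/-- The case `b = t` of the list of `eliminationOrder_of_isGenericWeight`, in another order. The
classes of the progression argument are the pairs with the same coefficient of `a`. -/
theorem eliminationOrder_of_isGenericShift (h2 : ∀ e : A, e + e = 0 → e = 0) {a t : A}
    (ht : IsGenericShift a t) :
    EliminationOrder 6 [t + t, a + t, a + (t + t), -(a + t), -a, -t] := by
  set good : ℤ × ℤ × ℤ → Bool := fun v => (v.1 ≠ 0 || v.2.1 ≠ 0) && v.1.natAbs ≤ 12 &&
    v.2.1.natAbs ≤ 18 && v.2.2 = 0 with hgooddef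
  have hgood : ∀ v, good v → evalCoeff a t 0 v ≠ 0 := by
    intro v hv
    simp only [hgooddef, Bool.or_eq_true, Bool.and_eq_true, decide_eq_true_eq] at hv
    obtain ⟨⟨⟨h1, h2⟩, h3⟩, -⟩ := hv
    simpa [evalCoeff] using ht _ _ h1 h2 h3
  have hmap : [t + t, a + t, a + (t + t), -(a + t), -a, -t] =
      [(0, 2, 0), (1, 1, 0), (1, 2, 0), (-1, -1, 0), (-1, 0, 0), (0, -1, 0)].map
        (evalCoeff a t 0) := by
    simp [evalCoeff, two_smul, add_comm]
  have hC : ∀ C ∈ [[(0, 2, 0), (0, -1, 0)], [(1, 1, 0), (1, 2, 0)], [(-1, -1, 0), (-1, 0, 0)]],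
      AvoidsProgressions 6 (C.map (evalCoeff a t 0)) := by
    simp only [List.forall_mem_cons, List.not_mem_nil, false_imp_iff, implies_true, and_true,
      List.map_cons, List.map_nil]
    exact ⟨avoidsProgressions_pair (by norm_num) h2 _ _,
      avoidsProgressions_pair (by norm_num) h2 _ _, avoidsProgressions_pair (by norm_num) h2 _ _⟩
  rw [hmap]
  refine eliminationOrder_of_levelCheck hgood (avoidsProgressions_of_mixingCheck hgood (Cs :=
    [[(0, 2, 0), (0, -1, 0)], [(1, 1, 0), (1, 2, 0)], [(-1, -1, 0), (-1, 0, 0)]]) ?_ (by simp)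
    hC (by simp)) ?_
  · decide +kernel
  · decide +kernel

theorem eliminationOrder_neg_double (h2 : ∀ e : A, e + e = 0 → e = 0) {s : A} (hs : s ≠ 0) :
    EliminationOrder 6 [-s, s + s] := by
  have hs2 : s + s ≠ 0 := fun h => hs (h2 s h)
  have hs4 : s + s + (s + s) ≠ 0 := fun h => hs2 (h2 _ h)
  refine ⟨?_, avoidsProgressions_pair (by norm_num) h2 _ _, ?_, ?_, trivial⟩
  · simp only [List.mem_cons, List.not_mem_nil, or_false, not_or]
    rintro h (rfl | rfl)
    · refine ⟨by simpa using hs, fun h => hs4 ?_⟩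
      rw [← neg_eq_zero, ← sub_eq_zero_of_eq h]
      abel
    · refine ⟨fun h => hs2 ?_, by simpa using hs⟩
      rw [← sub_eq_zero_of_eq h]
      abel
  · simpa using hs2
  · exact (avoidsProgressions_pair (by norm_num) h2 (s + s) (s + s)).mono (by simp)

end Orders

/-! ### The selective metabelian condition -/

section Selective

variable {K L : Type*} [CommRing K] [LieRing L] [LieAlgebra K L]

/-- The selective metabelian condition: `[[x, y], [z, w]] = 0` whenever no sum of a part of the
weights of `x, y` and a part of the weights of `z, w` vanishes. -/
def IsSelectivelyMetabelian {A : Type*} [AddCommGroup A] (g : A → Submodule K L) : Prop :=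
  ∀ ⦃a b c d : A⦄ ⦃x y z w : L⦄, x ∈ g a → y ∈ g b → z ∈ g c → w ∈ g d →
    (∀ v ∈ [a, b, a + b], ∀ u ∈ [c, d, c + d], v + u ≠ 0) → ⁅⁅x, y⁆, ⁅z, w⁆⁆ = 0

variable {n : ℕ} [NeZero n] {g : ZMod n → Submodule K L}

/-- If the list of weights is invariant under `j ↦ t - j`, then a bounded derived component of
weight `t` is spanned by brackets that avoid the list altogether. -/
theorem EliminationOrder.derivedIter_le_span {m : ℕ} {D : List (ZMod n)} {t : ZMod n}
    (hD : EliminationOrder m D) (hg : IsGradedFamily g) (h0 : g 0 = ⊥) (hDt : ∀ j ∈ D, t - j ∈ D) :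
    derivedIter g (eliminationBound m D.length + 1) t ≤ Submodule.span K
      {z | ∃ a b x y, a + b = t ∧ a ∉ D ∧ b ∉ D ∧ x ∈ g a ∧ y ∈ g b ∧ z = ⁅x, y⁆} := by
  refine derivedFamily_le fun a b x y hi hx hy => ?_
  refine hg.bracket_genFamily_mem le_rfl (S := {i | i ∉ D}) ?_ hi (hg.derivedIter_le _ a hx)
    (hD.derivedIter_le hg h0 b hy)
  intro a' c x' u hc hi' hx' hu
  refine Submodule.subset_span ⟨a', c, x', u, hi', fun ha' => hc ?_, hc, hx', hu, rfl⟩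
  have := hDt a' ha'
  rwa [← hi', add_sub_cancel_left] at this

/-- If `D` contains the negatives of `a, b, a + b` and is invariant under `j ↦ t - j`, the selective
condition applies to all brackets spanning the derived component of weight `t`. -/
theorem IsSelectivelyMetabelian.lie_lie_eq_zero (hs : IsSelectivelyMetabelian g)
    (hg : IsGradedFamily g) (h0 : g 0 = ⊥) {m : ℕ} {D : List (ZMod n)} {a b t : ZMod n} {x y u : L}
    (hx : x ∈ g a) (hy : y ∈ g b) (hD : EliminationOrder m D) (hDt : ∀ j ∈ D, t - j ∈ D)
    (ha : -a ∈ D) (hb : -b ∈ D) (hab : -(a + b) ∈ D) (hta : a + t ≠ 0) (htb : b + t ≠ 0)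
    (htab : a + b + t ≠ 0) (hu : u ∈ derivedIter g (eliminationBound m D.length + 1) t) :
    ⁅⁅x, y⁆, u⁆ = 0 := by
  have h := lie_mem_of_mem_span_right (Z := (⊥ : Submodule K L)) (x := ⁅x, y⁆) ?_
    (hD.derivedIter_le_span hg h0 hDt hu)
  · simpa using h
  · rintro _ ⟨c, d, z, w, hcd, hc, hd, hz, hw, rfl⟩
    rw [Submodule.mem_bot]
    refine hs hx hy hz hw ?_
    have hne : ∀ v, -v ∈ D → ∀ e, e ∉ D → v + e ≠ 0 := fun v hv e he h =>
      he (by rwa [← neg_eq_of_add_eq_zero_right h])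
    rw [hcd]
    simp only [List.forall_mem_cons, List.not_mem_nil, false_imp_iff, implies_true, and_true]
    exact ⟨⟨hne a ha c hc, hne a ha d hd, hta⟩, ⟨hne b hb c hc, hne b hb d hd, htb⟩,
      hne _ hab c hc, hne _ hab d hd, htab⟩

theorem IsSelectivelyMetabelian.lie_lie_eq_zero_of_isGenericWeight
    (hs : IsSelectivelyMetabelian g) (hg : IsGradedFamily g) (h0 : g 0 = ⊥)
    (h2 : ∀ e : ZMod n, e + e = 0 → e = 0) {a b t : ZMod n} {x y u : L}
    (ht : IsGenericWeight a b t) (ha : a ≠ 0) (hb : b ≠ 0) (hab : a + b ≠ 0) (h2ab : a + a ≠ b)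
    (hab2 : a + (b + b) ≠ 0) (haab : a + a + b ≠ 0) (hx : x ∈ g a) (hy : y ∈ g b)
    (hu : u ∈ derivedIter g (eliminationBound 6 6 + 1) t) : ⁅⁅x, y⁆, u⁆ = 0 := by
  refine hs.lie_lie_eq_zero hg h0 hx hy
    (eliminationOrder_of_isGenericWeight h2 ht ha hb hab h2ab hab2 haab) ?_ (by simp) (by simp)
    (by simp) ?_ ?_ ?_ hu
  · simp only [List.mem_cons, List.not_mem_nil, or_false]
    rintro j (rfl | rfl | rfl | rfl | rfl | rfl)
    exacts [.inr (.inr (.inr (.inr (.inr (by abel))))), .inr (.inr (.inr (.inr (.inl (by abel))))),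
      .inr (.inr (.inr (.inl (by abel)))), .inr (.inr (.inl (by abel))), .inr (.inl (by abel)),
      .inl (by abel)]
  · simpa [add_comm] using ht 1 1 0 (by simp) (by simp) (by simp) (by simp)
  · simpa [add_comm] using ht 1 0 1 (by simp) (by simp) (by simp) (by simp)
  · simpa [add_comm, add_left_comm] using ht 1 1 1 (by simp) (by simp) (by simp) (by simp)

theorem IsSelectivelyMetabelian.lie_lie_eq_zero_of_isGenericShift
    (hs : IsSelectivelyMetabelian g) (hg : IsGradedFamily g) (h0 : g 0 = ⊥)
    (h2 : ∀ e : ZMod n, e + e = 0 → e = 0) {a t : ZMod n} {x y u : L}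
    (ht : IsGenericShift a t) (hx : x ∈ g a) (hy : y ∈ g t)
    (hu : u ∈ derivedIter g (eliminationBound 6 6 + 1) t) : ⁅⁅x, y⁆, u⁆ = 0 := by
  refine hs.lie_lie_eq_zero hg h0 hx hy (eliminationOrder_of_isGenericShift h2 ht) ?_ (by simp)
    (by simp) (by simp) ?_ ?_ ?_ hu
  · simp only [List.mem_cons, List.not_mem_nil, or_false]
    rintro j (rfl | rfl | rfl | rfl | rfl | rfl)
    exacts [.inr (.inr (.inr (.inr (.inr (by abel))))), .inr (.inr (.inr (.inr (.inl (by abel))))),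
      .inr (.inr (.inr (.inl (by abel)))), .inr (.inr (.inl (by abel))), .inr (.inl (by abel)),
      .inl (by abel)]
  · simpa using ht 1 1 (by simp) (by simp) (by simp)
  · simpa [two_smul] using ht 0 2 (by simp) (by simp) (by simp)
  · simpa [two_smul, add_assoc] using ht 1 2 (by simp) (by simp) (by simp)

/-- Along a progression whose difference `t` has large order, the same relation `o • a + β • t = 0`
cannot hold at two places; as there are at most `25 * 37 = 925` such relations, some term
among the first `926` is generic. Two places differ by less than `1000` steps, whence the bound
`12000 = 12 * 1000` on the orders to be excluded. -/
theorem exists_isGenericShift {A : Type*} [AddCommGroup A] {t : A}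
    (ht : ∀ o : ℕ, 1 ≤ o → o ≤ 12000 → o • t ≠ 0) (c : A) :
    ∃ i ≤ 925, IsGenericShift (c + i • t) t := by
  by_contra! h
  have h' : ∀ i : ℕ, ∃ v : ℤ × ℤ, i ≤ 925 → v ∈ Finset.Icc (-12 : ℤ) 12 ×ˢ Finset.Icc (-18 : ℤ) 18 ∧
      (v.1 ≠ 0 ∨ v.2 ≠ 0) ∧ v.1 • (c + i • t) + v.2 • t = 0 := by
    intro i
    by_cases hi : i ≤ 925
    · have := h i hi
      simp only [IsGenericShift, not_forall, not_not] at this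
      obtain ⟨o, β, h1, h2, h3, h4⟩ := this
      refine ⟨(o, β), fun _ => ⟨?_, h1, h4⟩⟩
      simp only [Finset.mem_product, Finset.mem_Icc]
      omega
    · exact ⟨0, fun h => absurd h hi⟩
  choose v hv using h'
  obtain ⟨i, hi, j, hj, hij, he⟩ := Finset.exists_ne_map_eq_of_card_lt_of_maps_to
    (s := Finset.range 926) (t := Finset.Icc (-12 : ℤ) 12 ×ˢ Finset.Icc (-18 : ℤ) 18) (f := v)
    (by simp) (fun j hj => (hv j (by simpa [Nat.lt_succ_iff] using hj)).1)
  rw [Finset.mem_range] at hi hj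
  wlog hlt : i < j generalizing i j
  · exact this j hj i hi hij.symm he.symm (by omega)
  obtain ⟨hm, hne, hi0⟩ := hv i (by omega)
  obtain ⟨-, -, hj0⟩ := hv j (by omega)
  rw [← he] at hj0
  simp only [Finset.mem_product, Finset.mem_Icc] at hm
  have hz : ∀ k : ℤ, k ≠ 0 → k.natAbs ≤ 12000 → k • t ≠ 0 := by
    intro k hk hk' hkt
    refine ht k.natAbs (by omega) hk' ?_
    rcases Int.natAbs_eq k with h | h
    · rw [h, natCast_zsmul] at hkt; simpa using hkt
    · rw [h, neg_smul, natCast_zsmul, neg_eq_zero] at hkt; simpa using hkt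
  by_cases ho : (v i).1 = 0
  · refine hz (v i).2 (hne.resolve_left (by simpa using ho)) (by omega) ?_
    simpa [ho] using hi0
  · refine hz ((v i).1 * ((j : ℤ) - i)) (mul_ne_zero ho (by omega)) ?_ ?_
    · rw [Int.natAbs_mul]
      exact (Nat.mul_le_mul (show (v i).1.natAbs ≤ 12 by omega)
        (show ((j : ℤ) - i).natAbs ≤ 1000 by omega))
    · have e : ((v i).1 * ((j : ℤ) - i)) • t = ((v i).1 • (c + j • t) + (v i).2 • t) -
          ((v i).1 • (c + i • t) + (v i).2 • t) := by
        rw [mul_smul, sub_smul, natCast_zsmul, natCast_zsmul]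
        simp only [smul_add, smul_sub]
        abel
      rw [e, hi0, hj0, sub_zero]

/-- Engel condition for components whose weight has large order. -/
theorem IsSelectivelyMetabelian.lieWord_eq_zero
    (hs : IsSelectivelyMetabelian g) (hg : IsGradedFamily g) (h0 : g 0 = ⊥)
    (h2 : ∀ e : ZMod n, e + e = 0 → e = 0) {t : ZMod n}
    (ht : ∀ o : ℕ, 1 ≤ o → o ≤ 12000 → o • t ≠ 0) {c : ZMod n} {z : L} (hz : z ∈ g c)
    {l : List (ZMod n × L)} (hl : ∀ p ∈ l, p.1 = t)
    (hl' : ∀ p ∈ l, p.2 ∈ derivedIter g (eliminationBound 6 6 + 1) p.1) (hlen : 927 ≤ l.length) :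
    lieWord z l = 0 := by
  obtain ⟨i, hi, hgen⟩ := exists_isGenericShift ht c
  have hMg : derivedIter g (eliminationBound 6 6 + 1) ≤ g := hg.derivedIter_le _
  have hgM : AbsorbsFamily g (derivedIter g (eliminationBound 6 6 + 1)) :=
    fun _ _ _ _ _ hi hx hy => hg hi hx (hMg _ hy)
  have htake : (l.take i).length = i := by rw [List.length_take]; omega
  have hw : lieWord z (l.take i) ∈ g (c + i • t) := by
    refine lieWord_mem hgM (fun p hp => hl' p (List.mem_of_mem_take hp)) hz ?_
    rw [List.sum_map_fst_of_forall_eq fun p hp => hl p (List.mem_of_mem_take hp), htake]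
  have hdrop : ∀ p ∈ l.drop i, p ∈ l := fun p hp => List.mem_of_mem_drop hp
  have hdlen : 2 ≤ (l.drop i).length := by rw [List.length_drop]; omega
  rw [← List.take_append_drop i l, lieWord_append]
  match l.drop i, hdrop, hdlen with
  | p :: q :: l', hdrop, _ =>
    have hp := hdrop p (by simp)
    have hq := hdrop q (by simp)
    have hpM := hl' p hp
    have hqM := hl' q hq
    rw [hl p hp] at hpM
    rw [hl q hq] at hqM
    rw [lieWord_cons, lieWord_cons,
      hs.lie_lie_eq_zero_of_isGenericShift hg h0 h2 hgen hw (hMg _ hpM) hqM, lieWord_zero]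

end Selective

/-! ### Bounded derived length of graded families -/

section Bounded

variable {K L : Type*} [CommRing K] [LieRing L] [LieAlgebra K L] {n : ℕ} [NeZero n]
  {g : ZMod n → Submodule K L}

theorem ZMod.card_filter_zsmul_eq_le {o : ℤ} (ho : o ≠ 0) (c : ZMod n) :
    (Finset.univ.filter fun t : ZMod n => o • t = c).card ≤ o.natAbs := by
  classical
  rcases (Finset.univ.filter fun t : ZMod n => o • t = c).eq_empty_or_nonempty with h | ⟨t₀, ht₀⟩
  · rw [h]; exact Nat.zero_le _
  · refine le_trans ?_ (IsAddCyclic.card_nsmul_eq_zero_le (α := ZMod n) (Int.natAbs_pos.2 ho))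
    refine Finset.card_le_card_of_injOn (fun t => t - t₀) ?_ (sub_left_injective.injOn)
    intro t ht
    simp only [Finset.coe_filter, Finset.mem_univ, true_and, Set.mem_ofPred_eq,
      Finset.mem_filter] at ht ht₀ ⊢
    have h : o • (t - t₀) = 0 := by rw [smul_sub, ht, ht₀, sub_self]
    rcases Int.natAbs_eq o with h' | h'
    · rw [h', natCast_zsmul] at h; exact h
    · rw [h', neg_smul, natCast_zsmul, neg_eq_zero] at h; exact h

theorem exists_card_le_isGenericWeight (a b : ZMod n) :
    ∃ N : Finset (ZMod n), N.card ≤ 45000 ∧ ∀ t ∉ N, IsGenericWeight a b t := by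
  classical
  set I : Finset (ℤ × ℤ × ℤ) :=
    ((Finset.Icc (-6) 6).erase 0) ×ˢ Finset.Icc (-12) 12 ×ˢ Finset.Icc (-12) 12 with hI
  have hIcard : I.card = 7500 := by
    rw [hI, Finset.card_product, Finset.card_product, Finset.card_erase_of_mem (by simp)]
    simp
  refine ⟨I.biUnion fun v => Finset.univ.filter fun t => v.1 • t = -(v.2.1 • a + v.2.2 • b), ?_, ?_⟩
  · refine (Finset.card_biUnion_le_card_mul I _ 6 fun v hv => ?_).trans (by rw [hIcard])
    simp only [hI, Finset.mem_product, Finset.mem_erase, Finset.mem_Icc] at hv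
    exact (ZMod.card_filter_zsmul_eq_le hv.1.1 _).trans (by omega)
  · intro t ht o α β ho h1 h2 h3 h
    refine ht (Finset.mem_biUnion.2 ⟨(o, α, β), ?_, ?_⟩)
    · simp only [hI, Finset.mem_product, Finset.mem_erase, Finset.mem_Icc]
      exact ⟨⟨ho, by omega⟩, by omega, by omega⟩
    · simp only [Finset.mem_filter, Finset.mem_univ, true_and]
      rw [add_assoc] at h
      exact eq_neg_of_add_eq_zero_left h

/-- Bounded derived components are spanned by elements annihilated by all but boundedly many
components of another bounded term of the derived series. Eliminating `-s` and `s + s` excludes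
`a + 2 b = 0` and `2 a + b = 0` for the brackets of weight `s = a + b`. -/
theorem IsSelectivelyMetabelian.derivedIter_le_span_annihilated
    (hs : IsSelectivelyMetabelian g) (hg : IsGradedFamily g) (h0 : g 0 = ⊥)
    (h2 : ∀ e : ZMod n, e + e = 0 → e = 0) (s : ZMod n) :
    derivedIter g (eliminationBound 6 2 + 1) s ≤ Submodule.span K {x | x ∈ g s ∧
      ∃ N : Finset (ZMod n), N.card ≤ 45000 ∧
        ∀ t ∉ N, ∀ u ∈ derivedIter g (eliminationBound 6 6 + 1) t, ⁅x, u⁆ = 0} := by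
  by_cases hs0 : s = 0
  · subst hs0
    rw [derivedIter_apply_zero hg h0]
    exact bot_le
  refine ((eliminationOrder_neg_double h2 hs0).derivedIter_le_span hg h0 ?_).trans
    (Submodule.span_mono ?_)
  · simp only [List.mem_cons, List.not_mem_nil, or_false]
    rintro j (rfl | rfl)
    exacts [.inr (by abel), .inl (by abel)]
  · rintro _ ⟨a, b, x, y, hab, ha, hb, hx, hy, rfl⟩
    refine ⟨hg hab hx hy, ?_⟩
    by_cases ha0 : a = 0
    · subst ha0
      rw [h0, Submodule.mem_bot] at hx
      exact ⟨∅, by simp, fun t _ u _ => by rw [hx, zero_lie, zero_lie]⟩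
    by_cases hb0 : b = 0
    · subst hb0
      rw [h0, Submodule.mem_bot] at hy
      exact ⟨∅, by simp, fun t _ u _ => by rw [hy, lie_zero, zero_lie]⟩
    simp only [List.mem_cons, List.not_mem_nil, or_false, not_or] at ha hb
    have hsa : s + a ≠ 0 := fun h => ha.1 (eq_neg_of_add_eq_zero_right h)
    have hsb : s + b ≠ 0 := fun h => hb.1 (eq_neg_of_add_eq_zero_right h)
    have hab2 : a + (b + b) ≠ 0 := by rwa [← add_assoc, hab]
    have haab : a + a + b ≠ 0 := by rwa [add_assoc, hab, add_comm]
    by_cases h2ab : a + a = b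
    · obtain ⟨N, hN, hNt⟩ := exists_card_le_isGenericWeight b a
      refine ⟨N, hN, fun t ht u hu => ?_⟩
      rw [← lie_skew x y, neg_lie, hs.lie_lie_eq_zero_of_isGenericWeight hg h0 h2 (hNt t ht) hb0
        ha0 (by rwa [add_comm, hab]) ?_ (by rwa [add_comm]) (by rwa [add_comm]) hy hx hu, neg_zero]
      -- if `2 a = b` and `2 b = a`, then `a + b = 3 a = 0`
      intro h
      refine hs0 ?_
      have e : a + b = (b + b - a) + (a + a - b) := by abel
      rw [← hab, e, sub_eq_zero_of_eq h, sub_eq_zero_of_eq h2ab, add_zero]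
    · obtain ⟨N, hN, hNt⟩ := exists_card_le_isGenericWeight a b
      exact ⟨N, hN, fun t ht u hu => hs.lie_lie_eq_zero_of_isGenericWeight hg h0 h2 (hNt t ht) ha0
        hb0 (by rwa [hab]) h2ab hab2 haab hx hy hu⟩

/-- If `x` is annihilated by all components of `M` except those with weight in `N`, and elements of
large order satisfy an Engel condition, then the ideal generated by `x` under `M` involves boundedly
many weights, so that Shalev's theorem applies to the action of `M` on it. -/
theorem lie_derivedIter_eq_zero {M : ZMod n → Submodule K L} (hM : IsGradedFamily M) (hM0 : M 0 = ⊥)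
    {s : ZMod n} {x : L}
    {N : Finset (ZMod n)} {k₀ k r : ℕ} (hr : N.card ≤ r)
    (hN : ∀ t ∉ N, ∀ u ∈ M t, ⁅x, u⁆ = 0)
    (hE : ∀ t : ZMod n, (∀ o : ℕ, 1 ≤ o → o ≤ k₀ → o • t ≠ 0) → ∀ l : List (ZMod n × L),
      (∀ p ∈ l, p.1 = t) → (∀ p ∈ l, p.2 ∈ M p.1) → k ≤ l.length → lieWord x l = 0)
    (hk : 1 ≤ k) {i : ZMod n} {y : L}
    (hy : y ∈ derivedIter M (shalevBound (((k + k₀) ^ r) ^ 2)) i) : ⁅x, y⁆ = 0 := by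
  classical
  -- the weights that can occur in the ideal generated by `x` under `M`
  set Θ : Finset (ZMod n) := Finset.univ.image
    fun c : N → Fin (k + k₀) => s + ∑ t : N, (c t).val • (t : ZMod n) with hΘ
  have hΘcard : Θ.card ≤ (k + k₀) ^ r := by
    refine Finset.card_image_le.trans ?_
    rw [Finset.card_univ, Fintype.card_fun, Fintype.card_fin, Fintype.card_coe]
    exact Nat.pow_le_pow_right (by omega) hr
  have hword : ∀ m, ∀ l : List (ZMod n × L), l.length = m → (∀ p ∈ l, p.2 ∈ M p.1) →
      s + (l.map Prod.fst).sum ∉ Θ → lieWord x l = 0 := by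
    intro m
    induction m using Nat.strong_induction_on with
    | _ m ih =>
      intro l hlm hl hsum
      -- shorter words of the same weight vanish, so the letters commute
      have hperm : ∀ l' : List (ZMod n × L), l.Perm l' → lieWord x l' = 0 → lieWord x l = 0 := by
        intro l' hll' h'
        have h := lieWord_sub_mem_of_perm (Y := (⊥ : Submodule K L)) hll' x ?_
        · rwa [h', sub_zero, Submodule.mem_bot] at h
        · intro l₁ p q l₂ hp
          have hs : ∀ p' ∈ l₁ ++ p :: q :: l₂, p'.2 ∈ M p'.1 :=
            fun p' hp' => hl p' (hp.mem_iff.1 hp')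
          have hlen := hp.length_eq
          have hsum' := (hp.map Prod.fst).sum_eq
          simp only [List.map_append, List.map_cons, List.sum_append, List.sum_cons] at hsum'
          rw [Submodule.mem_bot]
          refine ih (m - 1) ?_ _ ?_ ?_ ?_
          · simp only [List.length_append, List.length_cons] at hlen
            omega
          · simp only [List.length_append, List.length_cons] at hlen ⊢
            omega
          · intro p' hp'
            simp only [List.mem_append, List.mem_cons] at hp'
            rcases hp' with h | rfl | h
            · exact hs p' (by simp [h])
            · exact hM rfl (hs p (by simp)) (hs q (by simp))
            · exact hs p' (by simp [h])
          · simp only [List.map_append, List.map_cons, List.sum_append, List.sum_cons]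
            rwa [add_assoc p.1, hsum']
      by_cases hlN : ∀ p ∈ l, p.1 ∈ N
      · by_cases hbig : ∃ t : ZMod n, (∀ o : ℕ, 1 ≤ o → o ≤ k₀ → o • t ≠ 0) ∧
            k ≤ (l.map Prod.fst).count t
        · obtain ⟨t, ht, htk⟩ := hbig
          obtain ⟨l₁, l₂, hp, hl₁, hlen⟩ := List.exists_perm_append_of_fst_eq l t
          refine hperm _ hp ?_
          rw [lieWord_append, hE t ht l₁ hl₁ (fun p hp' => hl p (hp.mem_iff.2 (by simp [hp'])))
            (by omega), lieWord_zero]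
        · exfalso
          push Not at hbig
          -- multiplicities of weights of small order may be reduced modulo the order
          have hc : ∀ t : ZMod n, ∃ c : Fin (k + k₀),
              (l.map Prod.fst).count t • t = c.val • t := by
            intro t
            by_cases ht : ∀ o : ℕ, 1 ≤ o → o ≤ k₀ → o • t ≠ 0
            · exact ⟨⟨_, (hbig t ht).trans_le (Nat.le_add_right _ _)⟩, rfl⟩
            · push Not at ht
              obtain ⟨o, ho1, ho2, ho⟩ := ht
              refine ⟨⟨(l.map Prod.fst).count t % o, ?_⟩, ?_⟩
              · have := Nat.mod_lt ((l.map Prod.fst).count t) ho1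
                omega
              · conv_lhs => rw [← Nat.mod_add_div ((l.map Prod.fst).count t) o]
                rw [add_smul, mul_comm o, mul_smul, ho, smul_zero, add_zero]
          choose c hc using hc
          refine hsum (Finset.mem_image.2 ⟨fun t => c t, Finset.mem_univ _, ?_⟩)
          rw [Finset.sum_list_count_of_subset (l.map Prod.fst) N (by
            intro t ht
            simp only [List.mem_toFinset, List.mem_map] at ht
            obtain ⟨p, hp, rfl⟩ := ht
            exact hlN p hp), Finset.sum_congr rfl fun t _ => hc t]
          rw [Finset.sum_coe_sort N fun t => (c t).val • t]
      · push Not at hlN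
        obtain ⟨p, hp, hpN⟩ := hlN
        have hpM := hl p hp
        obtain ⟨l₁, l₂, rfl⟩ := List.append_of_mem hp
        refine hperm _ List.perm_middle ?_
        rw [lieWord_cons, hN p.1 hpN p.2 hpM, lieWord_zero]
  -- the centralizer of the ideal
  set Z : Submodule K L := ⨅ l : {l : List (ZMod n × L) // ∀ p ∈ l, p.2 ∈ M p.1},
    LinearMap.ker (LieAlgebra.ad K L (lieWord x l.1)) with hZ
  have hmemZ : ∀ u, u ∈ Z ↔ ∀ l : List (ZMod n × L), (∀ p ∈ l, p.2 ∈ M p.1) →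
      ⁅lieWord x l, u⁆ = 0 := by
    intro u
    simp [hZ, Submodule.mem_iInf, Subtype.forall]
  have hZM : AbsorbsFamily (fun _ => Z) M := by
    intro a b i y u hi hyZ hu
    rw [hmemZ] at hyZ ⊢
    intro l hl
    have h := hyZ (l ++ [(b, u)]) (by
      simp only [List.mem_append, List.mem_singleton]
      rintro p (hp | rfl)
      exacts [hl p hp, hu])
    rw [lieWord_append, lieWord_cons, lieWord_nil] at h
    rw [leibniz_lie, hyZ l hl, zero_lie, zero_add, ← lie_skew, h, neg_zero]
  have hle := derivedIter_shalevBound_le (z := fun _ => Z) hM (by rw [hM0]; exact bot_le) hZM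
    (W := (Θ ×ˢ Θ).image fun p => p.1 - p.2) (r := ((k + k₀) ^ r) ^ 2) ?_ ?_
  · simpa using (hmemZ y).1 (hle i hy) [] (by simp)
  · intro e he u hu
    rw [hmemZ]
    intro l hl
    by_cases hl' : s + (l.map Prod.fst).sum ∈ Θ
    · have h := hword _ (l ++ [(e, u)]) rfl (by
        simp only [List.mem_append, List.mem_singleton]
        rintro p (hp | rfl)
        exacts [hl p hp, hu]) (by
          rw [List.map_append, List.sum_append, List.map_singleton, List.sum_singleton,
            ← add_assoc]
          intro h
          exact he (Finset.mem_image.2 ⟨(_, _), Finset.mk_mem_product h hl', by simp⟩))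
      simpa [lieWord_append] using h
    · rw [hword _ l rfl hl hl', zero_lie]
  · refine Finset.card_image_le.trans ?_
    rw [Finset.card_product, sq]
    exact Nat.mul_le_mul hΘcard hΘcard

/-- Selectively metabelian graded families with trivial zero component have derived length bounded
by an absolute constant. -/
theorem exists_forall_derivedIter_eq_bot.{u, v} : ∃ d : ℕ, ∀ {K : Type u} {L : Type v} [CommRing K]
    [LieRing L] [LieAlgebra K L] {n : ℕ} [NeZero n] {g : ZMod n → Submodule K L},
    (∀ e : ZMod n, e + e = 0 → e = 0) → IsGradedFamily g → g 0 = ⊥ →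
    IsSelectivelyMetabelian g → derivedIter g d = ⊥ := by
  obtain ⟨k₁, hk₁⟩ : ∃ k, k = eliminationBound 6 2 + 1 := ⟨_, rfl⟩
  obtain ⟨k₂, hk₂⟩ : ∃ k, k = eliminationBound 6 6 + 1 := ⟨_, rfl⟩
  obtain ⟨f, hf⟩ : ∃ f, f = shalevBound (((927 + 12000) ^ 45000) ^ 2) := ⟨_, rfl⟩
  refine ⟨max k₁ (k₂ + f) + 1, ?_⟩
  intro K L _ _ _ n _ g h2 hg h0 hs
  rw [eq_bot_iff]
  intro i
  refine derivedFamily_le fun a b x y hi hx hy => ?_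
  have hx := hg.derivedIter_antitone (le_max_left _ _) a hx
  have hy := hg.derivedIter_antitone (le_max_right _ _) b hy
  rw [hk₁] at hx
  rw [← derivedIter_derivedIter, hf] at hy
  refine lie_mem_of_mem_span_left ?_ (hs.derivedIter_le_span_annihilated hg h0 h2 a hx)
  rintro x ⟨hxg, N, hN, hNt⟩
  rw [← hk₂] at hNt
  refine (Submodule.mem_bot K).2 (lie_derivedIter_eq_zero (hg.derivedIter k₂)
    (derivedIter_apply_zero hg h0 _) (s := a) hN hNt ?_ (by norm_num) hy)
  intro t ht l hl hl' hlen
  rw [hk₂] at hl'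
  exact hs.lieWord_eq_zero hg h0 h2 ht hxg hl hl' hlen

end Bounded

/-! ### Eigenspaces of an automorphism -/

section Eigenspaces

variable {K L : Type*} [Field K] [LieRing L] [LieAlgebra K L] {n : ℕ}

/-- The eigenspace of `Ψ` for the value at `i` of an additive character of `ZMod n`. -/
def charEigenspace (Ψ : Module.End K L) (χ : AddChar (ZMod n) K) (i : ZMod n) : Submodule K L :=
  Module.End.eigenspace Ψ (χ i)

variable {Ψ η : Module.End K L} {χ : AddChar (ZMod n) K}

theorem mem_charEigenspace {i : ZMod n} {x : L} :
    x ∈ charEigenspace Ψ χ i ↔ Ψ x = χ i • x := Module.End.mem_eigenspace_iff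

theorem isGradedFamily_charEigenspace (hΨ : ∀ x y, Ψ ⁅x, y⁆ = ⁅Ψ x, Ψ y⁆) :
    IsGradedFamily (charEigenspace Ψ χ) := by
  rintro a b i x y rfl hx hy
  rw [mem_charEigenspace] at *
  rw [hΨ, hx, hy, smul_lie, lie_smul, smul_smul, AddChar.map_add_eq_mul]

theorem charEigenspace_zero (hΨ : ∀ x, Ψ x = x → x = 0) : charEigenspace Ψ χ 0 = ⊥ := by
  rw [eq_bot_iff]
  intro x hx
  rw [mem_charEigenspace, AddChar.map_zero_eq_one, one_smul] at hx
  exact hΨ x hx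

theorem apply_mem_charEigenspace_neg (hη : ∀ x, Ψ (η (Ψ x)) = η x) {i : ZMod n} {x : L}
    (hx : x ∈ charEigenspace Ψ χ i) : η x ∈ charEigenspace Ψ χ (-i) := by
  rw [mem_charEigenspace] at *
  have h := hη x
  rw [hx, map_smul, map_smul] at h
  rw [← h, smul_smul, ← AddChar.map_add_eq_mul, neg_add_cancel, AddChar.map_zero_eq_one, one_smul,
    h]

variable [NeZero n]

/-- The projection onto the eigenspace of weight `i`, as an average over the powers of `Ψ`. -/
def charProjection (Ψ : Module.End K L) (χ : AddChar (ZMod n) K) (i : ZMod n) : Module.End K L :=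
  (n : K)⁻¹ • ∑ j : ZMod n, χ (-(j * i)) • Ψ ^ j.val

theorem pow_val_apply_of_mem_charEigenspace {i : ZMod n} {x : L} (hx : x ∈ charEigenspace Ψ χ i)
    (j : ZMod n) : (Ψ ^ j.val) x = χ (j * i) • x := by
  have h : ∀ k : ℕ, (Ψ ^ k) x = χ (k * i) • x := by
    intro k
    induction k with
    | zero => simp
    | succ k ih =>
      rw [pow_succ', Module.End.mul_apply, ih, map_smul, mem_charEigenspace.1 hx, smul_smul,
        ← AddChar.map_add_eq_mul]
      congr 2
      push_cast
      ring
  rw [h, ZMod.natCast_zmod_val]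

theorem charProjection_apply_of_mem (hχ : χ.IsPrimitive) (hn : (n : K) ≠ 0) {i j : ZMod n} {x : L}
    (hx : x ∈ charEigenspace Ψ χ j) : charProjection Ψ χ i x = if j = i then x else 0 := by
  have h : ∀ k : ZMod n, χ (-(k * i)) • (Ψ ^ k.val) x = χ (k * (j - i)) • x := by
    intro k
    rw [pow_val_apply_of_mem_charEigenspace hx, smul_smul, ← AddChar.map_add_eq_mul]
    congr 2
    ring
  rw [charProjection, LinearMap.smul_apply, LinearMap.sum_apply]
  simp only [LinearMap.smul_apply, h]
  rw [← Finset.sum_smul, AddChar.sum_mulShift _ hχ, ZMod.card]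
  by_cases hij : j = i
  · simp [hij, smul_smul, hn]
  · simp [hij, sub_eq_zero]

theorem charProjection_mem (hΨ : Ψ ^ n = 1) (i : ZMod n) (x : L) :
    charProjection Ψ χ i x ∈ charEigenspace Ψ χ i := by
  rw [mem_charEigenspace, charProjection, LinearMap.smul_apply, LinearMap.sum_apply, map_smul,
    smul_comm (χ i), map_sum, Finset.smul_sum (r := χ i)]
  refine congrArg _ ?_
  refine Fintype.sum_equiv (Equiv.addRight 1) _ _ fun j => ?_
  have h : Ψ ^ (j + 1).val = Ψ * Ψ ^ j.val := by
    rw [← pow_succ', ZMod.val_add, ← pow_eq_pow_mod _ hΨ, pow_add, pow_succ]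
    congr 1
    rw [pow_eq_pow_mod (ZMod.val 1) hΨ, ZMod.val_one_eq_one_mod, Nat.mod_mod, ← pow_eq_pow_mod _ hΨ,
      pow_one]
  rw [Equiv.coe_addRight, h, LinearMap.smul_apply, LinearMap.smul_apply, map_smul,
    Module.End.mul_apply, smul_smul, ← AddChar.map_add_eq_mul]
  congr 2
  ring

theorem iSup_charEigenspace (hχ : χ.IsPrimitive) (hn : (n : K) ≠ 0) (hΨ : Ψ ^ n = 1) :
    ⨆ i, charEigenspace Ψ χ i = ⊤ := by
  rw [eq_top_iff]
  intro x _
  have h : ∑ i, charProjection Ψ χ i x = x := by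
    simp only [charProjection, LinearMap.smul_apply, LinearMap.sum_apply]
    rw [← Finset.smul_sum, Finset.sum_comm]
    simp only [← Finset.sum_smul]
    have h : ∀ j : ZMod n, ∑ i, χ (-(j * i)) = if j = 0 then (n : K) else 0 := by
      intro j
      have := AddChar.sum_mulShift (-j) hχ
      rw [ZMod.card] at this
      rw [Nat.cast_ite, Nat.cast_zero] at this
      simp only [neg_eq_zero] at this
      rw [← this]
      exact Finset.sum_congr rfl fun i _ => by congr 1; ring
    simp [h, hn, smul_smul]
  rw [← h]
  exact Submodule.sum_mem _ fun i _ =>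
    Submodule.mem_iSup_of_mem i (charProjection_mem hΨ i x)

/-- The metabelian identity on the elements `u + η u` yields the selective metabelian condition: in
the expansion of the identity, the term without `η` is the only one of its weight. -/
theorem isSelectivelyMetabelian_charEigenspace (hχ : χ.IsPrimitive) (hn : (n : K) ≠ 0)
    (h2 : ∀ e : ZMod n, e + e = 0 → e = 0)
    (hΨ : ∀ x y, Ψ ⁅x, y⁆ = ⁅Ψ x, Ψ y⁆) (hfix : ∀ x, Ψ x = x → x = 0)
    (hη : ∀ x, Ψ (η (Ψ x)) = η x)
    (hmet : ∀ x y z w, ⁅⁅x + η x, y + η y⁆, ⁅z + η z, w + η w⁆⁆ = 0) :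
    IsSelectivelyMetabelian (charEigenspace Ψ χ) := by
  intro a b c d x y z w hx hy hz hw hne
  have hg := isGradedFamily_charEigenspace (χ := χ) hΨ
  have h0 := charEigenspace_zero (χ := χ) hfix
  have hzero : ∀ {x : L}, x ∈ charEigenspace Ψ χ 0 → x = 0 := fun hx => by simpa [h0] using hx
  by_cases ha : a = 0
  · subst ha; rw [hzero hx]; simp
  by_cases hb : b = 0
  · subst hb; rw [hzero hy]; simp
  by_cases hab : a + b = 0
  · rw [hzero (hg hab hx hy), zero_lie]
  by_cases hc : c = 0
  · subst hc; rw [hzero hz]; simp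
  by_cases hd : d = 0
  · subst hd; rw [hzero hw]; simp
  by_cases hcd : c + d = 0
  · rw [hzero (hg hcd hz hw), lie_zero]
  simp only [List.forall_mem_cons, List.not_mem_nil, false_imp_iff, implies_true, and_true] at hne
  set π := charProjection Ψ χ (a + b + (c + d)) with hπ
  have key : ∀ v u p q, p ∈ charEigenspace Ψ χ (a + b - (v + v)) →
      q ∈ charEigenspace Ψ χ (c + d - (u + u)) → v + u ≠ 0 → π ⁅p, q⁆ = 0 := by
    intro v u p q hp hq hvu
    rw [hπ, charProjection_apply_of_mem hχ hn (hg rfl hp hq), if_neg]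
    intro h
    refine hvu (h2 _ ?_)
    rw [← sub_eq_zero_of_eq h.symm]
    abel
  have hx' := apply_mem_charEigenspace_neg hη hx
  have hy' := apply_mem_charEigenspace_neg hη hy
  have hz' := apply_mem_charEigenspace_neg hη hz
  have hw' := apply_mem_charEigenspace_neg hη hw
  have p0 : ⁅x, y⁆ ∈ charEigenspace Ψ χ (a + b - (0 + 0)) := hg (by abel) hx hy
  have p1 : ⁅η x, y⁆ ∈ charEigenspace Ψ χ (a + b - (a + a)) := hg (by abel) hx' hy
  have p2 : ⁅x, η y⁆ ∈ charEigenspace Ψ χ (a + b - (b + b)) := hg (by abel) hx hy'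
  have p3 : ⁅η x, η y⁆ ∈ charEigenspace Ψ χ (a + b - (a + b + (a + b))) := hg (by abel) hx' hy'
  have q0 : ⁅z, w⁆ ∈ charEigenspace Ψ χ (c + d - (0 + 0)) := hg (by abel) hz hw
  have q1 : ⁅η z, w⁆ ∈ charEigenspace Ψ χ (c + d - (c + c)) := hg (by abel) hz' hw
  have q2 : ⁅z, η w⁆ ∈ charEigenspace Ψ χ (c + d - (d + d)) := hg (by abel) hz hw'
  have q3 : ⁅η z, η w⁆ ∈ charEigenspace Ψ χ (c + d - (c + d + (c + d))) := hg (by abel) hz' hw'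
  have h := congrArg π (hmet x y z w)
  simp only [add_lie, lie_add, map_add, map_zero] at h
  obtain ⟨⟨n1, n2, n3⟩, ⟨n4, n5, n6⟩, n7, n8, n9⟩ := hne
  rw [key _ _ _ _ p0 q1 (by simpa using hc), key _ _ _ _ p0 q2 (by simpa using hd),
    key _ _ _ _ p0 q3 (by simpa using hcd), key _ _ _ _ p1 q0 (by simpa using ha),
    key _ _ _ _ p2 q0 (by simpa using hb), key _ _ _ _ p3 q0 (by simpa using hab),
    key _ _ _ _ p1 q1 n1, key _ _ _ _ p1 q2 n2, key _ _ _ _ p1 q3 n3,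
    key _ _ _ _ p2 q1 n4, key _ _ _ _ p2 q2 n5, key _ _ _ _ p2 q3 n6,
    key _ _ _ _ p3 q1 n7, key _ _ _ _ p3 q2 n8, key _ _ _ _ p3 q3 n9] at h
  rw [hπ, charProjection_apply_of_mem hχ hn (hg rfl (hg rfl hx hy) (hg rfl hz hw)),
    if_pos rfl] at h
  simpa using h

theorem exists_forall_derivedSeries_eq_bot_of_primitiveRoot.{u, v} : ∃ d : ℕ, ∀ {K : Type u}
    {L : Type v} [Field K] [LieRing L] [LieAlgebra K L] {n : ℕ} [NeZero n] {ζ : K}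
    {Ψ η : Module.End K L}, IsPrimitiveRoot ζ n → Odd n → (∀ x y, Ψ ⁅x, y⁆ = ⁅Ψ x, Ψ y⁆) →
    Ψ ^ n = 1 → (∀ x, Ψ x = x → x = 0) → (∀ x, Ψ (η (Ψ x)) = η x) →
    (∀ x y z w, ⁅⁅x + η x, y + η y⁆, ⁅z + η z, w + η w⁆⁆ = 0) →
    LieAlgebra.derivedSeries K L d = ⊥ := by
  obtain ⟨d, hd⟩ := exists_forall_derivedIter_eq_bot.{u, v}
  refine ⟨d, ?_⟩
  intro K L _ _ _ n _ ζ Ψ η hζ hodd hlie hΨ hfix hη hmet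
  have hn : (n : K) ≠ 0 := hζ.neZero'.out
  have h2 : ∀ e : ZMod n, e + e = 0 → e = 0 :=
    fun e he => (ZMod.add_self_eq_zero_iff_eq_zero hodd).1 he
  set χ := AddChar.zmodChar n hζ.pow_eq_one with hχdef
  have hχ : χ.IsPrimitive := AddChar.zmodChar_primitive_of_primitive_root n hζ
  have h := derivedSeries_le_iSup_derivedIter (iSup_charEigenspace hχ hn hΨ) d
  rw [hd h2 (isGradedFamily_charEigenspace hlie) (charEigenspace_zero hfix)
    (isSelectivelyMetabelian_charEigenspace hχ hn h2 hlie hfix hη hmet)] at h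
  rw [← LieSubmodule.toSubmodule_eq_bot, eq_bot_iff]
  exact h.trans (by simp)

end Eigenspaces

/-! ### Extension to the algebraic closure -/

section BaseChange

open scoped TensorProduct

variable {K L : Type*} [Field K] [LieRing L] [LieAlgebra K L]

theorem baseChange_lie (A : Type*) [CommRing A] [Algebra K A] (f : L →ₗ⁅K⁆ L) (x y : A ⊗[K] L) :
    (f : L →ₗ[K] L).baseChange A ⁅x, y⁆ =
      ⁅(f : L →ₗ[K] L).baseChange A x, (f : L →ₗ[K] L).baseChange A y⁆ :=
  LieHom.map_lie (LieAlgebra.ExtendScalars.map (AlgHom.id K A) f) x y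

theorem eq_zero_of_baseChange_apply_eq_self (A : Type*) [CommRing A] [Algebra K A]
    {f : L →ₗ[K] L} (hf : ∀ x, f x = x → x = 0) {x : A ⊗[K] L} (hx : f.baseChange A x = x) :
    x = 0 := by
  have hinj : Function.Injective (f - LinearMap.id : L →ₗ[K] L) := by
    rw [injective_iff_map_eq_zero]
    intro y hy
    exact hf y (sub_eq_zero.1 hy)
  have h := Module.Flat.lTensor_preserves_injective_linearMap (M := A) _ hinj
  refine (injective_iff_map_eq_zero _).1 h x ?_
  rw [LinearMap.lTensor_sub, LinearMap.lTensor_id, LinearMap.sub_apply, LinearMap.id_apply,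
    sub_eq_zero]
  exact hx

/-- The identity is multilinear in the four arguments, so that it suffices to check pure tensors. -/
theorem baseChange_lie_lie_eq_zero (A : Type*) [CommRing A] [Algebra K A] {f : L →ₗ[K] L}
    (hf : ∀ x y z w, ⁅⁅f x, f y⁆, ⁅f z, f w⁆⁆ = 0) (x y z w : A ⊗[K] L) :
    ⁅⁅f.baseChange A x, f.baseChange A y⁆, ⁅f.baseChange A z, f.baseChange A w⁆⁆ = 0 := by
  induction x using TensorProduct.induction_on with
  | zero => simp
  | add x₁ x₂ h₁ h₂ => rw [map_add, add_lie, add_lie, h₁, h₂, add_zero]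
  | tmul a x =>
  induction y using TensorProduct.induction_on with
  | zero => simp
  | add y₁ y₂ h₁ h₂ => rw [map_add, lie_add, add_lie, h₁, h₂, add_zero]
  | tmul b y =>
  induction z using TensorProduct.induction_on with
  | zero => simp
  | add z₁ z₂ h₁ h₂ => rw [map_add, add_lie, lie_add, h₁, h₂, add_zero]
  | tmul c z =>
  induction w using TensorProduct.induction_on with
  | zero => simp
  | add w₁ w₂ h₁ h₂ => rw [map_add, lie_add, lie_add, h₁, h₂, add_zero]
  | tmul d w =>
  simp only [LinearMap.baseChange_tmul, LieAlgebra.ExtendScalars.bracket_tmul, hf,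
    TensorProduct.tmul_zero]

theorem derivedSeries_eq_bot_of_baseChange (A : Type*) [CommRing A] [Algebra K A] [Nontrivial A]
    {d : ℕ} (h : LieAlgebra.derivedSeries A (A ⊗[K] L) d = ⊥) :
    LieAlgebra.derivedSeries K L d = ⊥ := by
  rw [eq_bot_iff] at h ⊢
  intro x hx
  rw [LieAlgebra.derivedSeries_baseChange] at h
  have hx' := h (Submodule.tmul_mem_baseChange_of_mem 1 hx)
  rw [LieSubmodule.mem_bot] at hx' ⊢
  rwa [Module.FaithfullyFlat.one_tmul_eq_zero_iff] at hx'

/-- The part of `n` prime to the characteristic. -/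
theorem exists_expChar_pow_mul_eq (K : Type*) [Field K] {n : ℕ} (hn : n ≠ 0) :
    ∃ q k m, ExpChar K q ∧ n = q ^ k * m ∧ (m : K) ≠ 0 := by
  obtain ⟨q, hq⟩ := ExpChar.exists K
  cases hq with
  | zero => exact ⟨1, 0, n, .zero, by simp, by exact_mod_cast hn⟩
  | prime hp =>
    rename_i hchar
    obtain ⟨k, m, hm, rfl⟩ := Nat.exists_eq_pow_mul_and_not_dvd hn q hp.ne_one
    exact ⟨q, k, m, .prime hp, rfl, fun h => hm ((CharP.cast_eq_zero_iff K q m).1 h)⟩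

/-- In characteristic `q` the maps `Φ ^ (q ^ k) - 1 = (Φ - 1) ^ (q ^ k)` and `Φ - 1` have trivial
kernels simultaneously. -/
theorem eq_zero_of_pow_expChar_pow_apply_eq_self {V : Type*} [AddCommGroup V] [Module K V] {q : ℕ}
    [ExpChar K q] {Φ : Module.End K V} (hΦ : ∀ x, Φ x = x → x = 0) (k : ℕ) {x : V}
    (hx : (Φ ^ q ^ k) x = x) : x = 0 := by
  have e : (Φ - 1) ^ q ^ k = Φ ^ q ^ k - 1 := by
    have h := congrArg (Polynomial.aeval Φ)
      (sub_pow_expChar_pow (Polynomial.X : Polynomial K) 1 (p := q) (n := k))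
    simpa using h
  have hinj : Function.Injective (Φ - 1 : Module.End K V) := by
    rw [injective_iff_map_eq_zero]
    intro y hy
    exact hΦ y (sub_eq_zero.1 hy)
  have hinj' : Function.Injective ((Φ - 1) ^ q ^ k : Module.End K V) := by
    rw [Module.End.coe_pow]
    exact hinj.iterate _
  refine (injective_iff_map_eq_zero _).1 hinj' x ?_
  rw [e, LinearMap.sub_apply, hx, Module.End.one_apply, sub_self]

/-- The main result for an automorphism `φ` of odd order without non-trivial fixed points and a map
`η` inverting it: the identity on the elements `u + η u` bounds the derived length. -/
theorem exists_forall_derivedSeries_eq_bot.{u, v} : ∃ d : ℕ, ∀ {K : Type u} {L : Type v} [Field K]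
    [LieRing L] [LieAlgebra K L] {n : ℕ} {φ η : L →ₗ⁅K⁆ L}, Odd n →
    (φ : Module.End K L) ^ n = 1 → (∀ x, φ x = x → x = 0) → (∀ x, φ (η (φ x)) = η x) →
    (∀ x y z w, ⁅⁅x + η x, y + η y⁆, ⁅z + η z, w + η w⁆⁆ = 0) →
    LieAlgebra.derivedSeries K L d = ⊥ := by
  obtain ⟨d, hd⟩ := exists_forall_derivedSeries_eq_bot_of_primitiveRoot.{u, max u v}
  refine ⟨d, ?_⟩
  intro K L _ _ _ n φ η hodd hφn hfix hη hmet
  obtain ⟨q, k, m, hq, rfl, hm⟩ := exists_expChar_pow_mul_eq K hodd.pos.ne'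
  have : NeZero (m : K) := ⟨hm⟩
  have : NeZero m := .of_neZero_natCast K
  have : ExpChar (AlgebraicClosure K) q := expChar_of_injective_algebraMap
    (algebraMap K (AlgebraicClosure K)).injective q
  obtain ⟨ζ, hζ⟩ := HasEnoughRootsOfUnity.exists_primitiveRoot (AlgebraicClosure K) m
  set Φ : Module.End (AlgebraicClosure K) (AlgebraicClosure K ⊗[K] L) :=
    (φ : L →ₗ[K] L).baseChange (AlgebraicClosure K) with hΦ
  set H : Module.End (AlgebraicClosure K) (AlgebraicClosure K ⊗[K] L) :=
    (η : L →ₗ[K] L).baseChange (AlgebraicClosure K) with hH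
  have hΦH : ∀ x, Φ (H (Φ x)) = H x := by
    intro x
    induction x using TensorProduct.induction_on with
    | zero => simp
    | add x y hx hy => simp only [map_add, hx, hy]
    | tmul a x => simp [hΦ, hH, hη]
  have hΦHr : ∀ r x, (Φ ^ r) (H ((Φ ^ r) x)) = H x := by
    intro r
    induction r with
    | zero => intro x; simp
    | succ r ih =>
      intro x
      conv_lhs => rw [pow_succ, Module.End.mul_apply, ← pow_succ, pow_succ', Module.End.mul_apply,
        hΦH]
      exact ih x
  have hΦlie : ∀ r x y, (Φ ^ r) ⁅x, y⁆ = ⁅(Φ ^ r) x, (Φ ^ r) y⁆ := by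
    intro r
    induction r with
    | zero => intro x y; simp
    | succ r ih =>
      intro x y
      rw [pow_succ', Module.End.mul_apply, ih, hΦ, baseChange_lie]
      rfl
  refine derivedSeries_eq_bot_of_baseChange (AlgebraicClosure K) (hd hζ (Nat.Odd.of_mul_right hodd)
    (Ψ := Φ ^ q ^ k) (η := H) (hΦlie _) ?_ ?_ (hΦHr _) ?_)
  · rw [← pow_mul, hΦ, ← LinearMap.baseChange_pow, hφn, LinearMap.baseChange_one]
  · intro x hx
    exact eq_zero_of_pow_expChar_pow_apply_eq_self
      (fun y hy => eq_zero_of_baseChange_apply_eq_self _ hfix hy) k hx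
  · intro x y z w
    have h := baseChange_lie_lie_eq_zero (AlgebraicClosure K)
      (f := LinearMap.id + (η : L →ₗ[K] L)) hmet x y z w
    simpa [LinearMap.baseChange_add] using h

end BaseChange

/-! ### Frobenius groups of automorphisms -/

section Frobenius

section Group

variable {A : Type*} [Group A] {F H : Subgroup A}

/-- An involution of the complement inverts an abelian kernel: `h` commutes with `f` times its
conjugate. -/
theorem IsFiniteFrobenius.conj_eq_inv (hFH : IsFiniteFrobenius F H) [IsCyclic ↥F] {h : A}
    (hh : h ∈ H) (h1 : h ≠ 1) (hsq : h * h = 1) {f : A} (hf : f ∈ F) : h * f * h⁻¹ = f⁻¹ := by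
  have hf' := hFH.conj_mem h hh f hf
  have hcomm : h * f * h⁻¹ * f = f * (h * f * h⁻¹) := by
    have hF : IsMulCommutative F := IsCyclic.isMulCommutative
    have := hF.is_comm.comm ⟨_, hf'⟩ ⟨f, hf⟩
    exact congrArg Subtype.val this
  have hinv : h⁻¹ = h := inv_eq_of_mul_eq_one_left hsq
  by_contra hne
  refine h1 (hFH.fixedPointFree (h * f * h⁻¹ * f) (F.mul_mem hf' hf)
    (fun he => hne (eq_inv_of_mul_eq_one_left he)) h hh ?_)
  rw [hinv] at hcomm ⊢
  calc h * (h * f * h * f) = h * h * f * h * f := by group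
    _ = f * h * f := by rw [hsq, one_mul]
    _ = f * h * f * (h * h) := by rw [hsq, mul_one]
    _ = f * (h * f * h) * h := by group
    _ = h * f * h * f * h := by rw [hcomm]

theorem IsFiniteFrobenius.odd_orderOf (hFH : IsFiniteFrobenius F H) [IsCyclic ↥F] {h : A}
    (hh : h ∈ H) (h1 : h ≠ 1) (hsq : h * h = 1) {f : A} (hf : f ∈ F) (hfin : IsOfFinOrder f) :
    Odd (orderOf f) := by
  rw [← Nat.not_even_iff_odd]
  rintro ⟨m, hm⟩
  have hpos := hfin.orderOf_pos
  have ht : f ^ m * f ^ m = 1 := by rw [← pow_add, ← hm, pow_orderOf_eq_one]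
  refine h1 (hFH.fixedPointFree (f ^ m) (F.pow_mem hf m)
    (pow_ne_one_of_lt_orderOf (by omega) (by omega)) h hh ?_)
  have h := hFH.conj_eq_inv hh h1 hsq (F.pow_mem hf m)
  rw [inv_eq_of_mul_eq_one_left ht] at h
  exact mul_inv_eq_iff_eq_mul.1 h

end Group

variable {K L : Type*} [CommRing K] [LieRing L] [LieAlgebra K L]

theorem LieEquiv.pow_toLinearMap (φ : L ≃ₗ⁅K⁆ L) (k : ℕ) :
    ((φ : L →ₗ⁅K⁆ L) : Module.End K L) ^ k =
      (((φ ^ k : L ≃ₗ⁅K⁆ L) : L →ₗ⁅K⁆ L) : Module.End K L) := by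
  induction k with
  | zero => rfl
  | succ k ih => rw [pow_succ, pow_succ, ih]; rfl

theorem LieEquiv.pow_apply_eq_self {φ : L ≃ₗ⁅K⁆ L} {x : L} (hx : φ x = x) (k : ℕ) :
    (φ ^ k) x = x := by
  induction k with
  | zero => rfl
  | succ k ih =>
    rw [pow_succ]
    change (φ ^ k) (φ x) = x
    rw [hx, ih]

theorem IsMetabelianLie.lie_lie_eq_zero {C : LieSubalgebra K L} (hC : IsMetabelianLie K ↥C)
    {x y z w : L} (hx : x ∈ C) (hy : y ∈ C) (hz : z ∈ C) (hw : w ∈ C) :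
    ⁅⁅x, y⁆, ⁅z, w⁆⁆ = 0 := by
  have hD : ∀ a b : C, ⁅a, b⁆ ∈ LieAlgebra.derivedSeries K C 1 := fun a b =>
    LieSubmodule.lie_mem_lie (LieSubmodule.mem_top a) (LieSubmodule.mem_top b)
  have h : ⁅⁅(⟨x, hx⟩ : C), (⟨y, hy⟩ : C)⁆, ⁅(⟨z, hz⟩ : C), (⟨w, hw⟩ : C)⁆⁆ ∈
      LieAlgebra.derivedSeries K C 2 := LieSubmodule.lie_mem_lie (hD _ _) (hD _ _)
  rw [show LieAlgebra.derivedSeries K C 2 = ⊥ from hC, LieSubmodule.mem_bot] at h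
  exact congrArg Subtype.val h

end Frobenius

theorem theorem1 :
    ∃ N : ℕ, ∀ (K : Type*) (L : Type*) [Field K] [LieRing L] [LieAlgebra K L]
      (F H : Subgroup (L ≃ₗ⁅K⁆ L)),
      IsFiniteFrobenius F H → IsCyclic ↥F → Nat.card ↥H = 2 →
      fixedPointSubalgebra F = ⊥ →
      IsMetabelianLie K ↥(fixedPointSubalgebra H) →
      DerivedLengthLE K L N := by
  obtain ⟨d, hd⟩ := exists_forall_derivedSeries_eq_bot
  refine ⟨d, ?_⟩
  intro K L _ _ _ F H hFH hF hH hfix hmet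
  obtain ⟨φ, hφ⟩ := hF.exists_generator
  have := hFH.finite
  have hFfin : Finite F :=
    Finite.of_injective _ (Subgroup.inclusion_injective (le_sup_left (b := H)))
  obtain ⟨a, b, hab, huniv⟩ := Nat.card_eq_two_iff.1 hH
  -- the involution of `H`
  obtain ⟨h, hh, h1, hall⟩ : ∃ h ∈ H, h ≠ 1 ∧ ∀ x ∈ H, x = 1 ∨ x = h := by
    have hmem : ∀ x : H, x = a ∨ x = b := fun x => by
      have : x ∈ ({a, b} : Set H) := huniv ▸ Set.mem_univ x
      simpa using this
    rcases hmem 1 with h | h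
    · refine ⟨b, b.2, fun hb => hab ?_, fun x hx => ?_⟩
      · rw [← h]; exact (Subtype.ext hb).symm
      · rcases hmem ⟨x, hx⟩ with h' | h'
        · left; rw [← h] at h'; exact congrArg Subtype.val h'
        · right; exact congrArg Subtype.val h'
    · refine ⟨a, a.2, fun ha => hab ?_, fun x hx => ?_⟩
      · rw [← h]; exact Subtype.ext ha
      · rcases hmem ⟨x, hx⟩ with h' | h'
        · right; exact congrArg Subtype.val h'
        · left; rw [← h] at h'; exact congrArg Subtype.val h'
  have hsq : h * h = 1 := (hall _ (H.mul_mem hh hh)).resolve_right fun he => h1 (by simpa using he)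
  have hφfin : IsOfFinOrder (φ : L ≃ₗ⁅K⁆ L) :=
    Submonoid.isOfFinOrder_coe.2 (isOfFinOrder_of_finite φ)
  have hφh : (φ : L ≃ₗ⁅K⁆ L) * h * φ = h := by
    have := hFH.conj_eq_inv hh h1 hsq φ.2
    rw [mul_inv_eq_iff_eq_mul] at this
    rw [mul_assoc, this, mul_inv_cancel_left]
  refine hd (n := orderOf (φ : L ≃ₗ⁅K⁆ L)) (φ := (φ : L ≃ₗ⁅K⁆ L)) (η := h)
    (hFH.odd_orderOf hh h1 hsq φ.2 hφfin) ?_ ?_ ?_ ?_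
  · rw [LieEquiv.pow_toLinearMap, pow_orderOf_eq_one]
    rfl
  · intro x hx
    have hx' : x ∈ fixedPointSubalgebra F := by
      intro f hf
      obtain ⟨k, hk⟩ := (isOfFinOrder_of_finite φ).mem_powers_iff_mem_zpowers.2 (hφ ⟨f, hf⟩)
      have hk' : (φ : L ≃ₗ⁅K⁆ L) ^ k = f := congrArg Subtype.val hk
      rw [← hk']
      exact LieEquiv.pow_apply_eq_self hx k
    rw [hfix] at hx'
    simpa using hx'
  · intro x
    exact DFunLike.congr_fun hφh x
  · have hfixH : ∀ x, x + h x ∈ fixedPointSubalgebra H := by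
      intro x ψ hψ
      rcases hall ψ hψ with rfl | rfl
      · rfl
      · rw [map_add]
        have : ψ (ψ x) = x := DFunLike.congr_fun hsq x
        rw [this, add_comm]
    intro x y z w
    exact hmet.lie_lie_eq_zero (hfixH x) (hfixH y) (hfixH z) (hfixH w)
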